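/- **Conventions.** Let $(X,d)$ be a metric space. A geodesic from $x$ to $y$ is a map $c:[0,l]\to X$ with $c(0)=x$, $c(l)=y$ and $d(c(s),c(t))=|s-t|$ for all $s,t\in[0,l]$ (so $l=d(x,y)$). $X$ is a $\mathrm{CAT}(1)$ space if any two points at distance less than $\pi$ are joined by a geodesic and, for every geodesic triangle with vertices $x,y,z$ and $d(x,y)+d(y,z)+d(z,x)<2\pi$ and every comparison triangle with vertices $\bar x,\bar y,\bar z$ in the unit sphere $\mathbb S^2$ (same side lengths for the spherical metric $d_{\mathbb S^2}$), one has $d(p,q)\le d_{\mathbb S^2}(\bar p,\bar q)$ for all points $p,q$ on the triangle and their comparison points $\bar p,\bar q$ (the comparison point of $p\in[x,y]$ is the point $\bar p\in[\bar x,\bar y]$ with $d_{\mathbb S^2}(\bar x,\bar p)=d(x,p)$, and likewise for the other sides). In a $\mathrm{CAT}(1)$ space the geodesic between two points at distance less than $\pi$ is unique; if $c$ is the geodesic from $x$ to $y$ and $t\in[0,1]$, put $tx\oplus(1-t)y:=c((1-t)d(x,y))$. For $T:X\to X$ let $F(T)=\{z: Tz=z\}$. $T$ is quasinonexpansive if $d(Tx,p)\le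 d(x,p)$ for all $x\in X$, $p\in F(T)$. A bounded sequence $\{x_n\}$ is $\Delta$-convergent to $z$ if for each of its subsequences $\{x_{n_i}\}$ the point $z$ is the only point $w$ of $X$ with $\limsup_i d(w,x_{n_i})=\inf_{y\in X}\limsup_i d(y,x_{n_i})$. $T$ is $\Delta$-demiclosed if, whenever $\{x_n\}$ is $\Delta$-convergent to $z$ and $d(Tx_n,x_n)\to0$, one has $z\in F(T)$. The $W$-mapping generated by $T_1,\dots,T_r:X\to X$ and $\alpha_1,\dots,\alpha_r\in[0,1]$ is $W=U_r$, where $U_0x=x$ and $U_kx=\alpha_kT_kU_{k-1}x\oplus(1-\alpha_k)x$ for $k=1,\dots,r$. **Theorem.** Let $X$ be a complete $\mathrm{CAT}(1)$ space such that $d(v,v')<\pi/2$ for all $v,v'\in X$. Let $T_1,\dots,T_r$ be quasinonexpansive and $\Delta$-demiclosed mappings of $X$ into itself such that $F:=\bigcap_{i=1}^rF(T_i)\neq\emptyset$. Let $0<a<1/2$ and let $\alpha_{n,i}\in[a,1-a]$ for all $n\in\mathbb N$ and $i=1,\dots,r$. Let $W_n$ be the $W$-mapping generated by $T_1,\dots,T_r$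 and $\alpha_{n,1},\dots,\alpha_{n,r}$. Let $\{\beta_n\}$ be a real sequence with $0<\beta_n<1$ for every $n$, $\lim_{n\to\infty}\beta_n=0$ and $\sum_{n=1}^\infty\beta_n=\infty$. Given $u,x_1\in X$, let $$x_{n+1}=\beta_nu\oplus(1-\beta_n)W_nx_n\qquad(n\in\mathbb N).$$ Then there is a unique point $P_Fu$ of $F$ nearest to $u$. Moreover, if one of the following conditions holds: (a) $\sup_{v,v'\in X}d(v,v')<\pi/2$; (b) $d(u,P_Fu)<\pi/4$ and $d(u,P_Fu)+d(x_1,P_Fu)<\pi/2$; (c) $\sum_{n=1}^\infty\beta_n^2=\infty$; then $\{x_n\}$ converges to $P_Fu$ (that is, $d(x_n,P_Fu)\to0$). -/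

import Mathlib

open Filter Topology

namespace CAT1

/-- The unit sphere of Euclidean three-space. -/
abbrev Sphere2 : Type := Metric.sphere (0 : EuclideanSpace ℝ (Fin 3)) 1

/-- The spherical metric: the angle between two unit vectors. -/
noncomputable def sphericalDist (p q : Sphere2) : ℝ :=
  InnerProductGeometry.angle (p : EuclideanSpace ℝ (Fin 3)) (q : EuclideanSpace ℝ (Fin 3))

/-- The points lying between `p` and `q` for the spherical metric. When `p` and `q` are not
antipodal this is the minimal great-circle arc from `p` to `q`. -/
def sphericalSegment (p q : Sphere2) : Set Sphere2 :=
  {m | sphericalDist p m + sphericalDist m q = sphericalDist p q}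

section Metric

variable {X : Type*} [MetricSpace X]

/-- `c`, restricted to `[0, dist x y]`, is a geodesic from `x` to `y`. -/
def IsGeodesic (c : ℝ → X) (x y : X) : Prop :=
  c 0 = x ∧ c (dist x y) = y ∧
    ∀ s ∈ Set.Icc 0 (dist x y), ∀ t ∈ Set.Icc 0 (dist x y), dist (c s) (c t) = |s - t|

/-- `S` is the image of a geodesic from `x` to `y`. -/
def IsGeodesicSegment (S : Set X) (x y : X) : Prop :=
  ∃ c : ℝ → X, IsGeodesic c x y ∧ S = c '' Set.Icc 0 (dist x y)

/-- For a side `S` of a geodesic triangle starting at `x`, and the endpoints `x'`, `y'` of the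
corresponding side of a comparison triangle: `p'` is the comparison point of `p ∈ S`. -/
def IsComparisonPoint (S : Set X) (x : X) (x' y' : Sphere2) (p : X) (p' : Sphere2) : Prop :=
  p ∈ S ∧ p' ∈ sphericalSegment x' y' ∧ sphericalDist x' p' = dist x p

/-- `p` is a point of the geodesic triangle with sides `A = [x,y]`, `B = [y,z]`, `C = [z,x]`, and
`p'` is a comparison point of `p` in the triangle with vertices `x'`, `y'`, `z'`. -/
def IsTriangleComparisonPoint (A B C : Set X) (x y z : X) (x' y' z' : Sphere2)
    (p : X) (p' : Sphere2) : Prop :=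
  IsComparisonPoint A x x' y' p p' ∨ IsComparisonPoint B y y' z' p p' ∨
    IsComparisonPoint C z z' x' p p'

variable (X) in
/-- CAT(1) spaces: points at distance less than `π` are joined by a geodesic, and geodesic
triangles of perimeter less than `2π` are not thicker than their comparison triangles in the
sphere. All sides of such a triangle are shorter than `π`; its comparison triangle is unique up to
an isometry of the sphere. -/
structure IsCAT1 : Prop where
  geodesic : ∀ x y : X, dist x y < Real.pi → ∃ c : ℝ → X, IsGeodesic c x y
  comparison : ∀ (x y z : X) (A B C : Set X),
    IsGeodesicSegment A x y → IsGeodesicSegment B y z → IsGeodesicSegment C z x →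
    dist x y + dist y z + dist z x < 2 * Real.pi →
    ∀ x' y' z' : Sphere2,
      sphericalDist x' y' = dist x y → sphericalDist y' z' = dist y z →
      sphericalDist z' x' = dist z x →
      ∀ (p q : X) (p' q' : Sphere2),
        IsTriangleComparisonPoint A B C x y z x' y' z' p p' →
        IsTriangleComparisonPoint A B C x y z x' y' z' q q' →
        dist p q ≤ sphericalDist p' q'

open Classical in
/-- The point `t x ⊕ (1 - t) y`: the point `c ((1 - t) * dist x y)` of a geodesic `c` from `x` to
`y`. In a CAT(1) space the geodesic is unique when `dist x y < π`. (If there is no geodesic, the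
value is irrelevant.) -/
noncomputable def convComb (t : ℝ) (x y : X) : X :=
  if h : ∃ c : ℝ → X, IsGeodesic c x y then h.choose ((1 - t) * dist x y) else x

/-- The W-mapping generated by `T 0, …, T (r-1)` and `α 0, …, α (r-1)`:
with `U₀ = I` and `Uₖ = αₖ TₖUₖ₋₁ ⊕ (1 - αₖ) I` for `k = 1, …, r`, it is `Uᵣ`. -/
noncomputable def wMapping : (r : ℕ) → (Fin r → X → X) → (Fin r → ℝ) → X → X
  | 0, _, _ => fun x => x
  | r + 1, T, α => fun x =>
      convComb (α (Fin.last r))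
        (T (Fin.last r) (wMapping r (fun i => T i.castSucc) (fun i => α i.castSucc) x)) x

/-- A map that does not increase the distance to any of its fixed points. -/
def Quasinonexpansive (T : X → X) : Prop :=
  ∀ x p : X, T p = p → dist (T x) p ≤ dist x p

/-- The asymptotic center of a (bounded) sequence. -/
def asymptoticCenter (x : ℕ → X) : Set X :=
  {z | limsup (fun n => dist z (x n)) atTop = ⨅ y : X, limsup (fun n => dist y (x n)) atTop}

/-- The bounded sequence `x` is Δ-convergent to `z`. -/
def DeltaTendsto (x : ℕ → X) (z : X) : Prop :=
  Bornology.IsBounded (Set.range x) ∧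
    ∀ φ : ℕ → ℕ, StrictMono φ → asymptoticCenter (x ∘ φ) = {z}

/-- The Δ-limit of every Δ-convergent sequence with `d (T xₙ, xₙ) → 0` is a fixed point of `T`. -/
def DeltaDemiclosed (T : X → X) : Prop :=
  ∀ (x : ℕ → X) (z : X), DeltaTendsto x z →
    Tendsto (fun n => dist (T (x n)) (x n)) atTop (𝓝 0) → T z = z

/-- `p` is a point of `C` at minimal distance from `u`. -/
def IsNearestPoint (C : Set X) (u p : X) : Prop :=
  p ∈ C ∧ ∀ q ∈ C, dist u p ≤ dist u q

end Metric

end CAT1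

namespace CAT1

open Real

/-! ### The comparison triangle and the cosine inequality -/

/-! All the geometry enters through one inequality, `IsCAT1.convComb_spec`: for m = tx ⊕ (1-t)y and
D = d(x,y), cos d(x,z) sin(tD) + cos d(y,z) sin((1-t)D) ≤ cos d(m,z) sin D. On the sphere it is an
equality, and comparison makes it an inequality in X. At t = 1/2 it is a uniform concavity of cos
d(·,z), giving nearest points, and, after passing to cos of limsup d(·,xₙ), unique asymptotic
centers and Δ-compactness.

Put sₙ = 1 - cos d(xₙ,p), with p the nearest point, and Dₙ = d(u,Wₙxₙ). The inequality gives sₙ₊₁ ≤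
(1-γₙ)(1 - cos d(Wₙxₙ,p)) + γₙ tₙ, with explicit γₙ (`exists_halpern_rate`) and tₙ = 1 - cos d(u,p)
cos(βₙDₙ/2) / cos(Dₙ - βₙDₙ/2). Since Wₙ does not decrease cos d(·,p), two cases arise at each late
step. If Wₙ raises that cosine by more than a fixed δ, this gain absorbs the error γₙ, because γₙ →
0. Otherwise the maps have approximate fixed points near xₙ (`wMapping_regular`), Δ-limits of such
xₙ lie in F, and minimality of d(u,p) makes tₙ ≤ ε (`eventually_anchor_le`). Either way sₙ₊₁ ≤
(1-γₙ)sₙ + γₙε, so sₙ → 0 once ∑γₙ = ∞. Conditions (a), (b), (c) serve only to prove this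
divergence, from γₙ ≥ (2/π)βₙ cos Dₙ or γₙ ≥ βₙ²/π. -/

theorem sphericalDist_eq_of_inner {p q : Sphere2} {θ : ℝ} (h0 : 0 ≤ θ) (hπ : θ ≤ π)
    (h : inner ℝ (p : EuclideanSpace ℝ (Fin 3)) q = cos θ) : sphericalDist p q = θ := by
  have hp : ‖(p : EuclideanSpace ℝ (Fin 3))‖ = 1 := by simp
  have hq : ‖(q : EuclideanSpace ℝ (Fin 3))‖ = 1 := by simp
  rw [sphericalDist, InnerProductGeometry.angle, hp, hq, h, mul_one, div_one, arccos_cos h0 hπ]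

theorem inner_eq_cos_sphericalDist (p q : Sphere2) :
    inner ℝ (p : EuclideanSpace ℝ (Fin 3)) q = cos (sphericalDist p q) := by
  have hp : ‖(p : EuclideanSpace ℝ (Fin 3))‖ = 1 := by simp
  have hq : ‖(q : EuclideanSpace ℝ (Fin 3))‖ = 1 := by simp
  rw [sphericalDist, InnerProductGeometry.cos_angle, hp, hq, mul_one, div_one]

theorem sphericalDist_self (p : Sphere2) : sphericalDist p p = 0 :=
  sphericalDist_eq_of_inner le_rfl pi_pos.le (by simp)

/-- By the spherical law of cosines, k is the cosine of the angle between the sides A and C. The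
triangle inequalities say cos(A+C) ≤ cos B ≤ cos(A-C), which is |k| ≤ 1. If sin A sin C = 0 the two
bounds coincide and any k works. -/
theorem exists_cos_eq_of_triangle {A B C : ℝ} (hA : 0 ≤ A) (hC : 0 ≤ C) (hAπ : A ≤ π / 2)
    (hCπ : C ≤ π / 2) (hBπ : B ≤ π / 2) (h1 : A ≤ B + C) (h2 : C ≤ A + B) (h3 : B ≤ A + C) :
    ∃ k : ℝ, k ^ 2 ≤ 1 ∧ cos A * cos C + sin A * sin C * k = cos B := by
  have hsA : 0 ≤ sin A := sin_nonneg_of_nonneg_of_le_pi hA (by linarith)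
  have hsC : 0 ≤ sin C := sin_nonneg_of_nonneg_of_le_pi hC (by linarith)
  have hB : 0 ≤ B := by linarith
  have hlow : cos (A + C) ≤ cos B := cos_le_cos_of_nonneg_of_le_pi hB (by linarith) h3
  have hupp : cos B ≤ cos (A - C) := by
    rw [← cos_abs (A - C)]
    exact cos_le_cos_of_nonneg_of_le_pi (abs_nonneg _) (by linarith)
      (abs_le.2 ⟨by linarith, by linarith⟩)
  rw [cos_add] at hlow
  rw [cos_sub] at hupp
  rcases (mul_nonneg hsA hsC).eq_or_lt with h0 | h0
  · exact ⟨1, by norm_num, by linarith⟩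
  · refine ⟨(cos B - cos A * cos C) / (sin A * sin C), ?_, ?_⟩
    · rw [sq_le_one_iff_abs_le_one, abs_le, le_div_iff₀ h0, div_le_iff₀ h0]
      constructor <;> linarith
    · rw [mul_div_cancel₀ _ h0.ne']
      ring

theorem exists_comparison_triangle {A B C : ℝ} (hA : 0 ≤ A) (hC : 0 ≤ C) (hAπ : A ≤ π / 2)
    (hCπ : C ≤ π / 2) (hBπ : B ≤ π / 2) (h1 : A ≤ B + C) (h2 : C ≤ A + B) (h3 : B ≤ A + C) :
    ∃ x y z : Sphere2, sphericalDist x y = A ∧ sphericalDist y z = B ∧ sphericalDist z x = C := by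
  obtain ⟨k, hk, hkB⟩ := exists_cos_eq_of_triangle hA hC hAπ hCπ hBπ h1 h2 h3
  have hk' : sqrt (1 - k ^ 2) ^ 2 = 1 - k ^ 2 := sq_sqrt (by linarith)
  let x : Sphere2 := ⟨!₂[1, 0, 0], by
    simp [EuclideanSpace.norm_eq, Fin.sum_univ_three]⟩
  let y : Sphere2 := ⟨!₂[cos A, sin A, 0], by
    simp [EuclideanSpace.norm_eq, Fin.sum_univ_three]⟩
  let z : Sphere2 := ⟨!₂[cos C, sin C * k, sin C * sqrt (1 - k ^ 2)], by
    have : cos C ^ 2 + (sin C * k) ^ 2 + (sin C * sqrt (1 - k ^ 2)) ^ 2 = 1 := by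
      rw [mul_pow, mul_pow, hk']
      linear_combination sin_sq_add_cos_sq C
    simp [EuclideanSpace.norm_eq, Fin.sum_univ_three, this]⟩
  refine ⟨x, y, z, sphericalDist_eq_of_inner hA (by linarith) ?_,
    sphericalDist_eq_of_inner (by linarith) (by linarith) ?_,
    sphericalDist_eq_of_inner hC (by linarith) ?_⟩
  · simp [x, y, PiLp.inner_apply, Fin.sum_univ_three]
  · simp [y, z, PiLp.inner_apply, Fin.sum_univ_three]
    linarith
  · simp [x, z, PiLp.inner_apply, Fin.sum_univ_three]

theorem exists_point_on_arc {x y : Sphere2} {D t : ℝ} (hD : 0 < D) (hDπ : D < π)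
    (ht : t ∈ Set.Icc (0 : ℝ) 1) (hxy : sphericalDist x y = D) :
    ∃ m : Sphere2, sphericalDist x m = (1 - t) * D ∧ sphericalDist m y = t * D ∧
      ∀ z : Sphere2, cos (sphericalDist m z) * sin D =
        cos (sphericalDist x z) * sin (t * D) + cos (sphericalDist y z) * sin ((1 - t) * D) := by
  have hs : 0 < sin D := sin_pos_of_pos_of_lt_pi hD hDπ
  have hin : inner ℝ (x : EuclideanSpace ℝ (Fin 3)) y = cos D := by
    rw [inner_eq_cos_sphericalDist, hxy]
  obtain ⟨ht0, ht1⟩ := ht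
  have hb : (1 - t) * D = D - t * D := by ring
  have htD : 0 ≤ t * D := by positivity
  have htD' : t * D ≤ D := by nlinarith
  have hsq := sin_sq_add_cos_sq D
  have hsq' := sin_sq_add_cos_sq (t * D)
  -- Spherical linear interpolation: the inner product with any z is then linear in those of x and
  -- y, which is the exact form of the cosine law to be transferred.
  let v : EuclideanSpace ℝ (Fin 3) :=
    (sin (t * D) / sin D) • (x : EuclideanSpace ℝ (Fin 3)) +
      (sin ((1 - t) * D) / sin D) • (y : EuclideanSpace ℝ (Fin 3))
  have hv : ‖v‖ = 1 := by
    have : ‖v‖ ^ 2 = 1 := by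
      rw [norm_add_sq_real, norm_smul, norm_smul, inner_smul_left, inner_smul_right, hin]
      simp only [norm_eq_of_mem_sphere, mul_one, Real.norm_eq_abs, sq_abs, conj_trivial]
      field_simp
      rw [mul_comm D, hb, sin_sub]
      linear_combination (-sin (t * D) ^ 2) * hsq + sin D ^ 2 * hsq'
    rw [← sqrt_sq (norm_nonneg v), this, sqrt_one]
  let m : Sphere2 := ⟨v, by simpa using hv⟩
  have key : ∀ z : Sphere2, inner ℝ (m : EuclideanSpace ℝ (Fin 3)) z * sin D =
      inner ℝ (x : EuclideanSpace ℝ (Fin 3)) z * sin (t * D) +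
        inner ℝ (y : EuclideanSpace ℝ (Fin 3)) z * sin ((1 - t) * D) := fun z => by
    simp only [m, v, inner_add_left, inner_smul_left, conj_trivial]
    field_simp
  refine ⟨m, ?_, ?_, fun z => by simpa only [inner_eq_cos_sphericalDist] using key z⟩
  · refine sphericalDist_eq_of_inner (by linarith) (by linarith) ?_
    have := key x
    rw [real_inner_self_eq_norm_sq, real_inner_comm, real_inner_comm x.1 y.1, hin] at this
    simp only [norm_eq_of_mem_sphere] at this
    apply mul_right_cancel₀ hs.ne'
    rw [this, hb, sin_sub, cos_sub]
    linear_combination (-sin (t * D)) * hsq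
  · refine sphericalDist_eq_of_inner htD (by linarith) ?_
    have := key y
    rw [real_inner_self_eq_norm_sq, hin] at this
    simp only [norm_eq_of_mem_sphere] at this
    apply mul_right_cancel₀ hs.ne'
    rw [this, hb, sin_sub]
    ring

section

variable {X : Type*} [MetricSpace X]

theorem IsGeodesic.mem_segment_right {c : ℝ → X} {x y : X} (h : IsGeodesic c x y) :
    y ∈ c '' Set.Icc 0 (dist x y) :=
  ⟨dist x y, ⟨dist_nonneg, le_rfl⟩, h.2.1⟩

/-- The spherical law governing the distance from a third point to a point of a geodesic. -/
theorem IsCAT1.convComb_spec (hX : IsCAT1 X) (hd : ∀ v v' : X, dist v v' < π / 2) (x y : X)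
    {t : ℝ} (ht : t ∈ Set.Icc (0 : ℝ) 1) :
    dist x (convComb t x y) = (1 - t) * dist x y ∧ dist (convComb t x y) y = t * dist x y ∧
      ∀ z, cos (dist x z) * sin (t * dist x y) + cos (dist y z) * sin ((1 - t) * dist x y) ≤
        cos (dist (convComb t x y) z) * sin (dist x y) := by
  have hgeo : ∀ v w : X, ∃ c : ℝ → X, IsGeodesic c v w := fun v w =>
    hX.geodesic v w (by linarith [hd v w, pi_pos])
  have hc : IsGeodesic (hgeo x y).choose x y := (hgeo x y).choose_spec
  have hm : convComb t x y = (hgeo x y).choose ((1 - t) * dist x y) := by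
    rw [convComb, dif_pos (hgeo x y)]
  rw [hm]
  set c := (hgeo x y).choose
  have hD : 0 ≤ dist x y := dist_nonneg
  obtain ⟨ht0, ht1⟩ := ht
  have hmem : (1 - t) * dist x y ∈ Set.Icc 0 (dist x y) := ⟨by nlinarith, by nlinarith⟩
  have hxm : dist x (c ((1 - t) * dist x y)) = (1 - t) * dist x y := by
    have := hc.2.2 0 ⟨le_rfl, hD⟩ _ hmem
    rw [hc.1] at this
    rw [this, zero_sub, abs_neg, abs_of_nonneg hmem.1]
  have hmy : dist (c ((1 - t) * dist x y)) y = t * dist x y := by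
    have := hc.2.2 _ hmem _ ⟨hD, le_rfl⟩
    rw [hc.2.1] at this
    rw [this, abs_of_nonpos (by linarith [hmem.2])]
    ring
  refine ⟨hxm, hmy, fun z => ?_⟩
  -- When x = y both sides vanish, so the inequality carries no information; this is why later uses
  -- that divide by a sine treat distance 0 separately.
  rcases hD.eq_or_lt with h0 | h0
  · simp [← h0]
  obtain ⟨cB, hB⟩ := hgeo y z
  obtain ⟨cC, hC⟩ := hgeo z x
  obtain ⟨x', y', z', hxy, hyz, hzx⟩ := exists_comparison_triangle (A := dist x y)
    (B := dist y z) (C := dist z x) dist_nonneg dist_nonneg (hd _ _).le (hd _ _).le (hd _ _).le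
    (by linarith [dist_triangle x z y, dist_comm x z, dist_comm y z])
    (by linarith [dist_triangle x y z, dist_comm x z])
    (by linarith [dist_triangle y x z, dist_comm x y, dist_comm x z])
  have hDπ : dist x y < π := by linarith [hd x y, pi_pos]
  obtain ⟨m', hxm', hmy', hz'⟩ := exists_point_on_arc h0 hDπ ⟨ht0, ht1⟩ hxy
  have hcomp := hX.comparison x y z _ _ _ ⟨c, hc, rfl⟩ ⟨cB, hB, rfl⟩ ⟨cC, hC, rfl⟩
    (by linarith [hd x y, hd y z, hd z x, pi_pos]) x' y' z' hxy hyz hzx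
    (c ((1 - t) * dist x y)) z m' z'
    (Or.inl ⟨⟨_, hmem, rfl⟩, by
      rw [sphericalSegment, Set.mem_ofPred_eq, hxm', hmy', hxy]; ring, by rw [hxm', hxm]⟩)
    (Or.inr (Or.inl ⟨hB.mem_segment_right, by
      rw [sphericalSegment, Set.mem_ofPred_eq, sphericalDist_self, add_zero], hyz⟩))
  have hxz : sphericalDist x' z' = dist x z := by
    rw [sphericalDist, InnerProductGeometry.angle_comm, ← sphericalDist, hzx, dist_comm]
  have := hz' z'
  rw [hxz, hyz] at this
  rw [← this]
  refine mul_le_mul_of_nonneg_right ?_ (sin_nonneg_of_nonneg_of_le_pi hD hDπ.le)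
  exact cos_le_cos_of_nonneg_of_le_pi dist_nonneg (InnerProductGeometry.angle_le_pi _ _) hcomp

end

/-! ### Midpoints, maximizers and nearest points -/

section

variable {X : Type*} [MetricSpace X]

theorem IsCAT1.midpoint_spec (hX : IsCAT1 X) (hd : ∀ v v' : X, dist v v' < π / 2) (x y z : X) :
    cos (dist x z) + cos (dist y z) ≤
      2 * cos (dist (convComb (1 / 2) x y) z) * cos (dist x y / 2) := by
  obtain ⟨h1, -, h3⟩ := hX.convComb_spec hd x y (t := 1 / 2) ⟨by norm_num, by norm_num⟩
  rcases (dist_nonneg (x := x) (y := y)).eq_or_lt with h0 | h0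
  · rw [← h0, mul_zero] at h1
    rw [← dist_eq_zero.1 h1, dist_eq_zero.1 h0.symm]
    simp [two_mul]
  · have hs : 0 < sin (dist x y / 2) :=
      sin_pos_of_pos_of_lt_pi (by linarith) (by linarith [hd x y, pi_pos])
    have h := h3 z
    rw [show (1 - 1 / 2 : ℝ) * dist x y = dist x y / 2 by ring,
      show (1 / 2 : ℝ) * dist x y = dist x y / 2 by ring,
      show sin (dist x y) = 2 * sin (dist x y / 2) * cos (dist x y / 2) by
        rw [← sin_two_mul]; congr 1; ring] at h
    refine le_of_mul_le_mul_right ?_ hs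
    linarith

/-- Existence and uniqueness of maximizers of functions that are uniformly concave in the sense
given by the cosine of the distance. -/
theorem existsUnique_isMaxOn [CompleteSpace X] (hd : ∀ v v' : X, dist v v' < π / 2) {C : Set X}
    (hC : IsClosed C) {φ : X → ℝ} (hφ : Continuous φ) (hφ1 : ∀ x, φ x ≤ 1)
    (hpos : ∃ x ∈ C, 0 < φ x)
    (hmid : ∀ x ∈ C, ∀ y ∈ C, ∃ m ∈ C, φ x + φ y ≤ 2 * φ m * cos (dist x y / 2)) :
    ∃! z, z ∈ C ∧ ∀ y ∈ C, φ y ≤ φ z := by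
  obtain ⟨x₀, hx₀, hx₀pos⟩ := hpos
  set S := sSup (φ '' C)
  have hbdd : BddAbove (φ '' C) := ⟨1, by rintro _ ⟨x, -, rfl⟩; exact hφ1 x⟩
  have hle : ∀ x ∈ C, φ x ≤ S := fun x hx => le_csSup hbdd ⟨x, hx, rfl⟩
  have hS : 0 < S := hx₀pos.trans_le (hle x₀ hx₀)
  -- Two near-maximizers are close: bounding φ at the midpoint by S and using cos s ≤ 1 - 2s²/π²
  -- turns the defect 2S - φ x - φ y into a bound on the squared distance. This gives both the
  -- Cauchy property and uniqueness.
  have hdist : ∀ x ∈ C, ∀ y ∈ C, dist x y ^ 2 ≤ π ^ 2 / S * (2 * S - φ x - φ y) := by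
    intro x hx y hy
    obtain ⟨m, hm, h⟩ := hmid x hx y hy
    have hnn : 0 ≤ dist x y := dist_nonneg
    have hcos : cos (dist x y / 2) ≤ 1 - 2 / π ^ 2 * (dist x y / 2) ^ 2 :=
      cos_le_one_sub_mul_cos_sq (by
        rw [abs_of_nonneg (by linarith)]; linarith [hd x y, pi_pos])
    have hc0 : 0 ≤ cos (dist x y / 2) :=
      cos_nonneg_of_neg_pi_div_two_le_of_le (by linarith [pi_pos]) (by linarith [hd x y, pi_pos])
    have h1 : φ x + φ y ≤ 2 * S * cos (dist x y / 2) :=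
      h.trans (mul_le_mul_of_nonneg_right (by linarith [hle m hm]) hc0)
    have h2 : φ x + φ y ≤ 2 * S * (1 - 2 / π ^ 2 * (dist x y / 2) ^ 2) :=
      h1.trans (mul_le_mul_of_nonneg_left hcos (by linarith))
    rw [div_mul_eq_mul_div, le_div_iff₀ hS]
    have hπ : 0 < π ^ 2 := by positivity
    calc dist x y ^ 2 * S = π ^ 2 * (2 * S * (2 / π ^ 2 * (dist x y / 2) ^ 2)) := by
          field_simp
      _ ≤ π ^ 2 * (2 * S - φ x - φ y) := mul_le_mul_of_nonneg_left (by linarith) hπ.le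
  have hseq : ∀ n : ℕ, ∃ x ∈ C, S - 1 / ((n : ℝ) + 1) < φ x := fun n => by
    have : S - 1 / ((n : ℝ) + 1) < S := by
      have : 0 < 1 / ((n : ℝ) + 1) := by positivity
      linarith
    obtain ⟨_, ⟨x, hx, rfl⟩, h⟩ := exists_lt_of_lt_csSup ((Set.nonempty_of_mem hx₀).image φ) this
    exact ⟨x, hx, h⟩
  choose x hxC hxS using hseq
  have hcauchy : CauchySeq x := by
    refine cauchySeq_of_le_tendsto_0 (fun N : ℕ => sqrt (π ^ 2 / S * (2 * (1 / ((N : ℝ) + 1)))))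
      (fun n m N hn hm => ?_) ?_
    · refine le_sqrt_of_sq_le ((hdist _ (hxC n) _ (hxC m)).trans ?_)
      refine mul_le_mul_of_nonneg_left ?_ (by positivity)
      have e1 : 1 / ((n : ℝ) + 1) ≤ 1 / ((N : ℝ) + 1) := by gcongr
      have e2 : 1 / ((m : ℝ) + 1) ≤ 1 / ((N : ℝ) + 1) := by gcongr
      linarith [hxS n, hxS m]
    · have := ((tendsto_one_div_add_atTop_nhds_zero_nat (𝕜 := ℝ)).const_mul 2).const_mul (π ^ 2 / S)
      simpa using this.sqrt
  obtain ⟨z, hz⟩ := cauchySeq_tendsto_of_complete hcauchy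
  have hzC : z ∈ C := hC.mem_of_tendsto hz (Eventually.of_forall hxC)
  have hzS : S ≤ φ z := by
    refine le_of_tendsto_of_tendsto' ?_ ((hφ.tendsto z).comp hz) (fun n => (hxS n).le)
    simpa using (tendsto_one_div_add_atTop_nhds_zero_nat (𝕜 := ℝ)).const_sub S
  refine ⟨z, ⟨hzC, fun y hy => (hle y hy).trans hzS⟩, fun w hw => ?_⟩
  have h := hdist w hw.1 z hzC
  have h0 : π ^ 2 / S * (2 * S - φ w - φ z) ≤ 0 :=
    mul_nonpos_of_nonneg_of_nonpos (by positivity) (by linarith [hw.2 z hzC])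
  exact dist_eq_zero.1 (pow_eq_zero_iff two_ne_zero |>.1
    (le_antisymm (h.trans h0) (sq_nonneg _)))

theorem IsCAT1.existsUnique_isNearestPoint [CompleteSpace X] (hX : IsCAT1 X)
    (hd : ∀ v v' : X, dist v v' < π / 2) {C : Set X} (hC : IsClosed C) (hne : C.Nonempty)
    (hmid : ∀ x ∈ C, ∀ y ∈ C, convComb (1 / 2) x y ∈ C) (u : X) :
    ∃! p, IsNearestPoint C u p := by
  have hiff : ∀ p, IsNearestPoint C u p ↔ p ∈ C ∧ ∀ q ∈ C, cos (dist q u) ≤ cos (dist p u) := by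
    intro p
    refine and_congr_right fun _ => forall₂_congr fun q _ => ?_
    rw [dist_comm u p, dist_comm u q]
    have hmem : ∀ w : X, dist w u ∈ Set.Icc 0 π :=
      fun w => ⟨dist_nonneg, by linarith [hd w u, pi_pos]⟩
    exact (strictAntiOn_cos.le_iff_ge (hmem q) (hmem p)).symm
  simp only [hiff]
  obtain ⟨x₀, hx₀⟩ := hne
  refine existsUnique_isMaxOn hd hC (by fun_prop) (fun x => cos_le_one _) ⟨x₀, hx₀, ?_⟩
    (fun x hx y hy => ⟨_, hmid x hx y hy, hX.midpoint_spec hd x y u⟩)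
  exact cos_pos_of_mem_Ioo ⟨by linarith [pi_pos, dist_nonneg (x := x₀) (y := u)], hd _ _⟩

/-! ### Asymptotic centers -/

theorem cos_le_cos_add {a b ε : ℝ} (ha : 0 ≤ a) (hb : b ≤ π) (hε : 0 ≤ ε) (h : a ≤ b + ε) :
    cos b ≤ cos a + ε := by
  rcases le_total a b with hab | hab
  · linarith [cos_le_cos_of_nonneg_of_le_pi ha hb hab]
  · have := abs_cos_sub_cos_le b a
    have h1 : |b - a| ≤ ε := abs_le.2 ⟨by linarith, by linarith⟩
    linarith [le_abs_self (cos b - cos a)]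

section limsup

variable {ι : Type*}

theorem isCoboundedUnder_dist (l : Filter ι) (x : ι → X) [l.NeBot] (y : X) :
    IsCoboundedUnder (· ≤ ·) l (fun n => dist y (x n)) :=
  (isBoundedUnder_of ⟨0, fun _ => dist_nonneg⟩ :
    IsBoundedUnder (· ≥ ·) l (fun n => dist y (x n))).isCoboundedUnder_le

theorem isBoundedUnder_dist (hd : ∀ v v' : X, dist v v' < π / 2)
    (l : Filter ι) (x : ι → X) (y : X) : IsBoundedUnder (· ≤ ·) l (fun n => dist y (x n)) :=
  isBoundedUnder_of ⟨π / 2, fun n => (hd y (x n)).le⟩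

theorem limsup_dist_nonneg (hd : ∀ v v' : X, dist v v' < π / 2)
    (l : Filter ι) (x : ι → X) [l.NeBot] (y : X) : 0 ≤ limsup (fun n => dist y (x n)) l :=
  le_limsup_of_frequently_le (Frequently.of_forall fun _ => dist_nonneg)
    (isBoundedUnder_dist hd l x y)

theorem limsup_dist_le (hd : ∀ v v' : X, dist v v' < π / 2)
    (l : Filter ι) (x : ι → X) [l.NeBot] (y : X) : limsup (fun n => dist y (x n)) l ≤ π / 2 :=
  limsup_le_of_le (isCoboundedUnder_dist l x y) (Eventually.of_forall fun _ => (hd _ _).le)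

theorem eventually_dist_lt (hd : ∀ v v' : X, dist v v' < π / 2)
    (l : Filter ι) (x : ι → X) [l.NeBot] {y : X} {b : ℝ} (h : limsup (fun n => dist y (x n)) l < b) :
    ∀ᶠ n in l, dist y (x n) < b :=
  eventually_lt_of_limsup_lt h (isBoundedUnder_dist hd l x y)

theorem frequently_lt_dist (l : Filter ι) (x : ι → X) [l.NeBot] {y : X} {b : ℝ}
    (h : b < limsup (fun n => dist y (x n)) l) : ∃ᶠ n in l, b < dist y (x n) :=
  frequently_lt_of_lt_limsup (isCoboundedUnder_dist l x y) h

theorem limsup_dist_mono (hd : ∀ v v' : X, dist v v' < π / 2)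
    (l : Filter ι) (x : ι → X) {l' : Filter ι} [l.NeBot] (hl : l ≤ l') (y : X) :
    limsup (fun n => dist y (x n)) l ≤ limsup (fun n => dist y (x n)) l' :=
  limsup_le_limsup_of_le hl (isCoboundedUnder_dist l x y) (isBoundedUnder_dist hd l' x y)

theorem limsup_dist_le_add (hd : ∀ v v' : X, dist v v' < π / 2)
    (l : Filter ι) (x : ι → X) [l.NeBot] (y z : X) : limsup (fun n => dist y (x n)) l ≤
    dist y z + limsup (fun n => dist z (x n)) l := by
  refine le_of_forall_pos_le_add fun ε hε => ?_
  refine limsup_le_of_le (isCoboundedUnder_dist l x y) ?_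
  filter_upwards [eventually_dist_lt hd l x (lt_add_of_pos_right _ hε)] with n hn
  linarith [dist_triangle y z (x n)]

theorem continuous_limsup_dist (hd : ∀ v v' : X, dist v v' < π / 2)
    (l : Filter ι) (x : ι → X) [l.NeBot] :
    Continuous fun y => limsup (fun n => dist y (x n)) l := by
  refine (LipschitzWith.of_le_add fun y z => ?_).continuous
  linarith [limsup_dist_le_add hd l x y z]

/-- One index suffices: take n where d(m,xₙ) nearly reaches its limsup while d(v,xₙ) and d(w,xₙ)
barely exceed theirs. The pointwise inequality at this n loses at most ε per cosine, hence 3ε, since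
cos is 1-Lipschitz and the sines are at most 1. -/
theorem IsCAT1.limsup_convComb (hX : IsCAT1 X) (hd : ∀ v v' : X, dist v v' < π / 2)
    (l : Filter ι) (x : ι → X) [l.NeBot] (v w : X) {t : ℝ}
    (ht : t ∈ Set.Icc (0 : ℝ) 1) :
    cos (limsup (fun n => dist v (x n)) l) * sin (t * dist v w) +
        cos (limsup (fun n => dist w (x n)) l) * sin ((1 - t) * dist v w) ≤
      cos (limsup (fun n => dist (convComb t v w) (x n)) l) * sin (dist v w) := by
  obtain ⟨-, -, h⟩ := hX.convComb_spec hd v w ht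
  set m := convComb t v w
  have hD : 0 ≤ dist v w := dist_nonneg
  have hDπ : dist v w ≤ π := by linarith [hd v w, pi_pos]
  obtain ⟨ht0, ht1⟩ := ht
  have s1 : 0 ≤ sin (t * dist v w) :=
    sin_nonneg_of_nonneg_of_le_pi (by positivity) (by nlinarith)
  have s2 : 0 ≤ sin ((1 - t) * dist v w) :=
    sin_nonneg_of_nonneg_of_le_pi (mul_nonneg (by linarith) hD) (by nlinarith)
  have s3 : 0 ≤ sin (dist v w) := sin_nonneg_of_nonneg_of_le_pi hD hDπ
  have hπ : ∀ y, limsup (fun n => dist y (x n)) l ≤ π := fun y => by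
    linarith [limsup_dist_le hd l x y, pi_pos]
  refine le_of_forall_pos_le_add fun δ hδ => ?_
  obtain ⟨ε, hε, rfl⟩ : ∃ ε > 0, 3 * ε = δ := ⟨δ / 3, by positivity, by ring⟩
  obtain ⟨n, hn3, hn1, hn2⟩ := ((frequently_lt_dist l x (sub_lt_self
      (limsup (fun n => dist m (x n)) l) hε)).and_eventually
    ((eventually_dist_lt hd l x (lt_add_of_pos_right (limsup (fun n => dist v (x n)) l) hε)).and
      (eventually_dist_lt hd l x (lt_add_of_pos_right (limsup (fun n => dist w (x n)) l)
        hε)))).exists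
  have c1 := cos_le_cos_add dist_nonneg (hπ v) hε.le hn1.le
  have c2 := cos_le_cos_add dist_nonneg (hπ w) hε.le hn2.le
  have c3 := cos_le_cos_add (limsup_dist_nonneg hd l x m) (b := dist m (x n))
    (by linarith [hd m (x n), pi_pos]) hε.le (by linarith)
  have := h (x n)
  nlinarith [sin_le_one (t * dist v w), sin_le_one ((1 - t) * dist v w), sin_le_one (dist v w)]

end limsup

theorem IsCAT1.limsup_midpoint (hX : IsCAT1 X) (hd : ∀ v v' : X, dist v v' < π / 2)
    {ι : Type*} (l : Filter ι) [l.NeBot] (x : ι → X) (v w : X) :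
    cos (limsup (fun n => dist v (x n)) l) + cos (limsup (fun n => dist w (x n)) l) ≤
      2 * cos (limsup (fun n => dist (convComb (1 / 2) v w) (x n)) l) * cos (dist v w / 2) := by
  have h := hX.limsup_convComb hd l x v w (t := 1 / 2) ⟨by norm_num, by norm_num⟩
  obtain ⟨h1, -, -⟩ := hX.convComb_spec hd v w (t := 1 / 2) ⟨by norm_num, by norm_num⟩
  rcases (dist_nonneg (x := v) (y := w)).eq_or_lt with h0 | h0
  · rw [← h0, mul_zero] at h1
    rw [← dist_eq_zero.1 h1, dist_eq_zero.1 h0.symm]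
    simp [two_mul]
  · have hs : 0 < sin (dist v w / 2) :=
      sin_pos_of_pos_of_lt_pi (by linarith) (by linarith [hd v w, pi_pos])
    rw [show (1 - 1 / 2 : ℝ) * dist v w = dist v w / 2 by ring,
      show (1 / 2 : ℝ) * dist v w = dist v w / 2 by ring,
      show sin (dist v w) = 2 * sin (dist v w / 2) * cos (dist v w / 2) by
        rw [← sin_two_mul]; congr 1; ring] at h
    refine le_of_mul_le_mul_right ?_ hs
    linarith

theorem mem_asymptoticCenter_iff (hd : ∀ v v' : X, dist v v' < π / 2) {x : ℕ → X} {z : X} :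
    z ∈ asymptoticCenter x ↔ ∀ y, limsup (fun n => dist z (x n)) atTop ≤
      limsup (fun n => dist y (x n)) atTop := by
  have : Nonempty X := ⟨z⟩
  have hbdd : BddBelow (Set.range fun y => limsup (fun n => dist y (x n)) atTop) :=
    ⟨0, by rintro _ ⟨y, rfl⟩; exact limsup_dist_nonneg hd _ _ y⟩
  constructor
  · intro h y
    exact (show _ = _ from h).trans_le (ciInf_le hbdd y)
  · intro h
    exact le_antisymm (le_ciInf h) (ciInf_le hbdd z)

theorem IsCAT1.exists_asymptoticCenter_eq [CompleteSpace X] (hX : IsCAT1 X)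
    (hd : ∀ v v' : X, dist v v' < π / 2) {x : ℕ → X} {p : X}
    (hp : limsup (fun n => dist p (x n)) atTop < π / 2) : ∃ z, asymptoticCenter x = {z} := by
  obtain ⟨z, ⟨-, hz⟩, huniq⟩ := existsUnique_isMaxOn hd isClosed_univ
    (φ := fun y => cos (limsup (fun n => dist y (x n)) atTop))
    (continuous_cos.comp (continuous_limsup_dist hd atTop x)) (fun _ => cos_le_one _)
    ⟨p, Set.mem_univ p, cos_pos_of_mem_Ioo
      ⟨by linarith [limsup_dist_nonneg hd atTop x p, pi_pos], hp⟩⟩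
    (fun v _ w _ => ⟨_, Set.mem_univ _, hX.limsup_midpoint hd atTop x v w⟩)
  have hmem : ∀ y, limsup (fun n => dist y (x n)) atTop ∈ Set.Icc 0 π := fun y =>
    ⟨limsup_dist_nonneg hd _ _ y, by linarith [limsup_dist_le hd atTop x y, pi_pos]⟩
  refine ⟨z, Set.eq_singleton_iff_unique_mem.2 ⟨?_, fun w hw => ?_⟩⟩
  · rw [mem_asymptoticCenter_iff hd]
    exact fun y => (strictAntiOn_cos.le_iff_ge (hmem y) (hmem z)).1 (hz y (Set.mem_univ y))
  · rw [mem_asymptoticCenter_iff hd] at hw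
    exact huniq w ⟨Set.mem_univ w, fun y _ =>
      (strictAntiOn_cos.le_iff_ge (hmem y) (hmem w)).2 (hw y)⟩

/-- A monotone function of filters is constant along the subsequences of a suitable sequence. -/
theorem exists_strictMono_forall_le {R : Filter ℕ → ℝ} (hR0 : ∀ l, l.NeBot → 0 ≤ R l)
    (hR : ∀ l l' : Filter ℕ, l.NeBot → l ≤ l' → R l ≤ R l') :
    ∃ φ : ℕ → ℕ, StrictMono φ ∧ ∀ θ : ℕ → ℕ, StrictMono θ →
      R (map φ atTop) ≤ R (map (φ ∘ θ) atTop) := by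
  -- Filters replace nested subsequences and their diagonal. A decreasing chain almost minimizes `R`
  -- at each stage; countable generation survives the infimum, so a genuine subsequence converges to
  -- it.
  let P := {l : Filter ℕ // l.NeBot ∧ l.IsCountablyGenerated}
  have hstep : ∀ (k : ℕ) (l : P), ∃ l' : P, l'.1 ≤ l.1 ∧
      ∀ l'' : P, l''.1 ≤ l.1 → R l'.1 ≤ R l''.1 + 1 / ((k : ℝ) + 1) := by
    intro k l
    let s : Set ℝ := {b | ∃ l' : P, l'.1 ≤ l.1 ∧ R l'.1 = b}
    have hs : BddBelow s := ⟨0, by rintro _ ⟨l', -, rfl⟩; exact hR0 _ l'.2.1⟩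
    obtain ⟨_, ⟨l', hl', rfl⟩, h⟩ := exists_lt_of_csInf_lt (s := s) ⟨_, l, le_rfl, rfl⟩
      (lt_add_of_pos_right (sInf s) (by positivity : 0 < 1 / ((k : ℝ) + 1)))
    exact ⟨l', hl', fun l'' hl'' => by linarith [csInf_le hs ⟨l'', hl'', rfl⟩]⟩
  choose next hnext hmin using hstep
  let L : ℕ → P := fun n => Nat.rec ⟨atTop, inferInstance, inferInstance⟩ (fun k l => next k l) n
  have hanti : Antitone fun n => (L n).1 := antitone_nat_of_succ_le fun n => hnext n (L n)
  have : ∀ n, (L n).1.NeBot := fun n => (L n).2.1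
  have : ∀ n, (L n).1.IsCountablyGenerated := fun n => (L n).2.2
  have hne : (⨅ n, (L n).1).NeBot := iInf_neBot_of_directed hanti.directed_ge fun n => (L n).2.1
  have hcg : (⨅ n, (L n).1).IsCountablyGenerated := inferInstance
  have htop : (⨅ n, (L n).1) ≤ atTop := iInf_le (fun n => (L n).1) 0
  obtain ⟨φ, hφ, hφl⟩ := subseq_tendsto_of_neBot (f := ⨅ n, (L n).1) (u := id)
    (by rwa [map_id, inf_eq_left.2 htop])
  rw [Function.id_comp] at hφl
  refine ⟨φ, hφ, fun θ hθ => le_of_forall_pos_le_add fun ε hε => ?_⟩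
  obtain ⟨k, hk⟩ := exists_nat_one_div_lt hε
  have hle : map (φ ∘ θ) atTop ≤ (L k).1 :=
    (hφl.comp hθ.tendsto_atTop).trans (iInf_le (fun n => (L n).1) k)
  have h1 := hmin k (L k) ⟨map (φ ∘ θ) atTop, inferInstance, inferInstance⟩ hle
  have h2 : R (map φ atTop) ≤ R (L (k + 1)).1 :=
    hR _ _ inferInstance (hφl.trans (iInf_le (fun n => (L n).1) (k + 1)))
  exact h2.trans (h1.trans (by simp only; linarith))

theorem isBounded_of_dist_lt (hd : ∀ v v' : X, dist v v' < π / 2) (s : Set X) :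
    Bornology.IsBounded s :=
  Metric.isBounded_iff.2 ⟨π / 2, fun _ _ _ _ => (hd _ _).le⟩

/-- Choose a subsequence whose asymptotic radius does not drop along further subsequences. Its
center z then satisfies, for each of them, limsup d(z,·) ≤ old radius ≤ new radius, so z is a center
there too; centers are unique because d(p,xₙ) ≤ M < π/2. -/
theorem IsCAT1.exists_deltaTendsto_subseq [CompleteSpace X] (hX : IsCAT1 X)
    (hd : ∀ v v' : X, dist v v' < π / 2) {x : ℕ → X} {p : X} {M : ℝ} (hM : M < π / 2)
    (hp : ∀ n, dist p (x n) ≤ M) :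
    ∃ φ : ℕ → ℕ, StrictMono φ ∧ ∃ z, DeltaTendsto (x ∘ φ) z := by
  have : Nonempty X := ⟨p⟩
  let R : Filter ℕ → ℝ := fun l => ⨅ y : X, limsup (fun n => dist y (x n)) l
  have hbdd : ∀ l : Filter ℕ, l.NeBot →
      BddBelow (Set.range fun y => limsup (fun n => dist y (x n)) l) := fun l hl =>
    ⟨0, by rintro _ ⟨y, rfl⟩; exact limsup_dist_nonneg hd _ _ y⟩
  obtain ⟨φ, hφ, hreg⟩ := exists_strictMono_forall_le (R := R)
    (fun l hl => le_ciInf fun y => limsup_dist_nonneg hd l x y)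
    (fun l l' hl hll' => ciInf_mono (hbdd l hl) fun y => limsup_dist_mono hd l x hll' y)
  have hcenter : ∀ ψ : ℕ → ℕ, ∃ z, asymptoticCenter (x ∘ ψ) = {z} := fun ψ =>
    hX.exists_asymptoticCenter_eq hd (p := p) (lt_of_le_of_lt
      (limsup_le_of_le (isCoboundedUnder_dist atTop (x ∘ ψ) p)
        (Eventually.of_forall fun n => hp _)) hM)
  obtain ⟨z, hz⟩ := hcenter φ
  refine ⟨φ, hφ, z, isBounded_of_dist_lt hd _, fun θ hθ => ?_⟩
  obtain ⟨w, hw⟩ := hcenter (φ ∘ θ)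
  have hzmem : z ∈ asymptoticCenter (x ∘ φ ∘ θ) := by
    have hz' : z ∈ asymptoticCenter (x ∘ φ) := hz ▸ Set.mem_singleton z
    have e1 : limsup (fun n => dist z (x n)) (map φ atTop) = R (map φ atTop) := hz'
    rw [mem_asymptoticCenter_iff hd]
    intro y
    have e2 : limsup (fun n => dist z (x n)) (map (φ ∘ θ) atTop) ≤
        limsup (fun n => dist z (x n)) (map φ atTop) :=
      limsup_dist_mono hd _ x (by
        rw [← map_map]; exact map_mono hθ.tendsto_atTop) z
    exact (e2.trans (e1.trans_le (hreg θ hθ))).trans (ciInf_le (hbdd _ inferInstance) y)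
  rw [Function.comp_assoc, hw]
  rw [hw, Set.mem_singleton_iff] at hzmem
  rw [hzmem]

theorem DeltaTendsto.comp {x : ℕ → X} {z : X} (h : DeltaTendsto x z) {φ : ℕ → ℕ}
    (hφ : StrictMono φ) : DeltaTendsto (x ∘ φ) z :=
  ⟨h.1.subset (Set.range_comp_subset_range _ _), fun θ hθ => h.2 (φ ∘ θ) (hφ.comp hθ)⟩

theorem DeltaTendsto.mem_asymptoticCenter {x : ℕ → X} {z : X} (h : DeltaTendsto x z) :
    z ∈ asymptoticCenter x := by
  have := h.2 id strictMono_id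
  rw [Function.comp_id] at this
  rw [this]
  exact Set.mem_singleton z

theorem limsup_dist_congr (hd : ∀ v v' : X, dist v v' < π / 2) {x y : ℕ → X}
    (hxy : Tendsto (fun n => dist (y n) (x n)) atTop (𝓝 0)) (w : X) :
    limsup (fun n => dist w (x n)) atTop = limsup (fun n => dist w (y n)) atTop := by
  have key : ∀ x y : ℕ → X, Tendsto (fun n => dist (y n) (x n)) atTop (𝓝 0) →
      limsup (fun n => dist w (x n)) atTop ≤ limsup (fun n => dist w (y n)) atTop := by
    intro x y hxy
    refine le_of_forall_pos_le_add fun ε hε => ?_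
    refine limsup_le_of_le (isCoboundedUnder_dist _ x w) ?_
    filter_upwards [eventually_dist_lt hd atTop y (lt_add_of_pos_right
      (limsup (fun n => dist w (y n)) atTop) (half_pos hε)),
      hxy.eventually (gt_mem_nhds (half_pos hε))] with n h1 h2
    linarith [dist_triangle w (y n) (x n)]
  exact le_antisymm (key x y hxy) (key y x (by simpa only [dist_comm] using hxy))

theorem DeltaTendsto.congr_dist (hd : ∀ v v' : X, dist v v' < π / 2) {x y : ℕ → X} {z : X}
    (h : DeltaTendsto x z) (hxy : Tendsto (fun n => dist (y n) (x n)) atTop (𝓝 0)) :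
    DeltaTendsto y z := by
  refine ⟨isBounded_of_dist_lt hd _, fun φ hφ => ?_⟩
  rw [← h.2 φ hφ]
  ext w
  have hc := fun v => limsup_dist_congr hd (x := x ∘ φ) (y := y ∘ φ)
    (hxy.comp hφ.tendsto_atTop) v
  simp only [mem_asymptoticCenter_iff hd, hc]

/-- A derivative comparison at t = 0: both sides contain the factor 2 sin(tD/2), and after
cancelling it one lets t decrease to 0. -/
theorem le_cos_of_forall_mul_sin_le {A D : ℝ} (hD : 0 < D) (hDπ : D < π / 2)
    (h : ∀ t ∈ Set.Ioo (0 : ℝ) 1, A * sin (t * D) ≤ sin D - sin ((1 - t) * D)) :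
    A ≤ cos D := by
  have h' : ∀ t ∈ Set.Ioo (0 : ℝ) 1, A * cos (t * D / 2) ≤ cos (D - t * D / 2) := by
    intro t ht
    have htD : 0 < t * D := mul_pos ht.1 hD
    have htD' : t * D < D := by nlinarith [ht.2]
    have hs : 0 < 2 * sin (t * D / 2) :=
      mul_pos two_pos (sin_pos_of_pos_of_lt_pi (by linarith) (by linarith))
    have h0 := h t ht
    rw [sin_sub_sin, show (D - (1 - t) * D) / 2 = t * D / 2 by ring,
      show (D + (1 - t) * D) / 2 = D - t * D / 2 by ring,
      show sin (t * D) = 2 * sin (t * D / 2) * cos (t * D / 2) by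
        rw [← sin_two_mul]; congr 1; ring] at h0
    refine le_of_mul_le_mul_left ?_ hs
    linarith
  have h1 : Tendsto (fun t : ℝ => A * cos (t * D / 2)) (𝓝[>] 0) (𝓝 A) := by
    have : Continuous fun t : ℝ => A * cos (t * D / 2) := by fun_prop
    simpa using (this.tendsto 0).mono_left nhdsWithin_le_nhds
  have h2 : Tendsto (fun t : ℝ => cos (D - t * D / 2)) (𝓝[>] 0) (𝓝 (cos D)) := by
    have : Continuous fun t : ℝ => cos (D - t * D / 2) := by fun_prop
    simpa using (this.tendsto 0).mono_left nhdsWithin_le_nhds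
  refine le_of_tendsto_of_tendsto h1 h2 ?_
  filter_upwards [Ioo_mem_nhdsGT (zero_lt_one' ℝ)] with t ht using h' t ht

/-- First variation at a center: moving from z towards u cannot lower limsup d(·,xₙ), and the cosine
inequality turns this into a one-sided derivative condition at z. -/
theorem IsCAT1.dist_le_limsup (hX : IsCAT1 X) (hd : ∀ v v' : X, dist v v' < π / 2)
    {x : ℕ → X} {z : X} (hz : z ∈ asymptoticCenter x) (u : X) :
    dist u z ≤ limsup (fun n => dist u (x n)) atTop := by
  rw [mem_asymptoticCenter_iff hd] at hz
  rcases (dist_nonneg (x := u) (y := z)).eq_or_lt with h0 | h0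
  · rw [← h0]
    exact limsup_dist_nonneg hd _ x u
  have hmem : ∀ y, limsup (fun n => dist y (x n)) atTop ∈ Set.Icc 0 π := fun y =>
    ⟨limsup_dist_nonneg hd _ _ y, by linarith [limsup_dist_le hd atTop x y, pi_pos]⟩
  refine (strictAntiOn_cos.le_iff_ge (hmem u)
    ⟨dist_nonneg, by linarith [hd u z, pi_pos]⟩).1 ?_
  refine le_cos_of_forall_mul_sin_le h0 (hd u z) fun t ht => ?_
  have h := hX.limsup_convComb hd atTop x u z (t := t) ⟨ht.1.le, ht.2.le⟩
  have hm := cos_le_cos_of_nonneg_of_le_pi (hmem z).1 (hmem _).2 (hz (convComb t u z))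
  have s1 : 0 ≤ sin (dist u z) :=
    sin_nonneg_of_nonneg_of_le_pi h0.le (by linarith [hd u z, pi_pos])
  have s2 : sin ((1 - t) * dist u z) ≤ sin (dist u z) :=
    sin_le_sin_of_le_of_le_pi_div_two (by nlinarith [pi_pos, ht.2]) (hd u z).le
      (by nlinarith [ht.1])
  have hc := cos_le_one (limsup (fun n => dist z (x n)) atTop)
  nlinarith

end

/-! ### Quasinonexpansive maps and W-mappings -/

section

variable {X : Type*} [MetricSpace X]

theorem cos_dist_nonneg (hd : ∀ v v' : X, dist v v' < π / 2) (x y : X) : 0 ≤ cos (dist x y) :=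
  cos_nonneg_of_neg_pi_div_two_le_of_le (by linarith [pi_pos, dist_nonneg (x := x) (y := y)])
    (hd x y).le

theorem mul_sin_le_sin_mul {t D : ℝ} (ht : t ∈ Set.Icc (0 : ℝ) 1) (hD : D ∈ Set.Icc 0 π) :
    t * sin D ≤ sin (t * D) := by
  have := strictConcaveOn_sin_Icc.concaveOn.2 hD ⟨le_rfl, pi_pos.le⟩ ht.1
    (sub_nonneg.2 ht.2) (by ring)
  simpa using this

theorem IsCAT1.eq_left_of_dist_eq_zero (hX : IsCAT1 X) (hd : ∀ v v' : X, dist v v' < π / 2)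
    {x y : X} {t : ℝ} (ht : t ∈ Set.Icc (0 : ℝ) 1) (h : dist x y = 0) : convComb t x y = x := by
  have h1 := (hX.convComb_spec hd x y ht).1
  rw [h, mul_zero] at h1
  exact (dist_eq_zero.1 h1).symm

theorem IsCAT1.concave_cos_dist (hX : IsCAT1 X) (hd : ∀ v v' : X, dist v v' < π / 2) (x y z : X)
    {t : ℝ} (ht : t ∈ Set.Icc (0 : ℝ) 1) :
    t * cos (dist x z) + (1 - t) * cos (dist y z) ≤ cos (dist (convComb t x y) z) := by
  rcases (dist_nonneg (x := x) (y := y)).eq_or_lt with h0 | h0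
  · rw [hX.eq_left_of_dist_eq_zero hd ht h0.symm, dist_eq_zero.1 h0.symm]
    linarith
  have hD : dist x y ∈ Set.Icc 0 π := ⟨h0.le, by linarith [hd x y, pi_pos]⟩
  have hs : 0 < sin (dist x y) := sin_pos_of_pos_of_lt_pi h0 (by linarith [hd x y, pi_pos])
  have h := (hX.convComb_spec hd x y ht).2.2 z
  have e1 := mul_le_mul_of_nonneg_left (mul_sin_le_sin_mul ht hD) (cos_dist_nonneg hd x z)
  have e2 := mul_le_mul_of_nonneg_left
    (mul_sin_le_sin_mul (t := 1 - t) ⟨by linarith [ht.2], by linarith [ht.1]⟩ hD)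
    (cos_dist_nonneg hd y z)
  refine le_of_mul_le_mul_right ?_ hs
  linarith

/-- Sum-to-product gives sin(tD) + sin((1-t)D) = 2 sin(D/2) cos((1/2-t)D), and sin(D/2) cancels. For
A > 0, D > 0 and 0 < t < 1 this is a strict gain over A, which is what forces D to be small in
`wMapping_regular`. -/
theorem IsCAT1.mul_cos_le_convComb (hX : IsCAT1 X) (hd : ∀ v v' : X, dist v v' < π / 2)
    {x y z : X} {t A : ℝ} (ht : t ∈ Set.Icc (0 : ℝ) 1) (hx : A ≤ cos (dist x z))
    (hy : A ≤ cos (dist y z)) :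
    A * cos ((1 / 2 - t) * dist x y) ≤
      cos (dist (convComb t x y) z) * cos (dist x y / 2) := by
  rcases (dist_nonneg (x := x) (y := y)).eq_or_lt with h0 | h0
  · rw [hX.eq_left_of_dist_eq_zero hd ht h0.symm, ← h0]
    simpa using hx
  have hDπ : dist x y < π := by linarith [hd x y, pi_pos]
  have hs : 0 < sin (dist x y / 2) := sin_pos_of_pos_of_lt_pi (by linarith) (by linarith)
  have h := (hX.convComb_spec hd x y ht).2.2 z
  have s1 : 0 ≤ sin (t * dist x y) :=
    sin_nonneg_of_nonneg_of_le_pi (mul_nonneg ht.1 h0.le) (by nlinarith [ht.2])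
  have s2 : 0 ≤ sin ((1 - t) * dist x y) :=
    sin_nonneg_of_nonneg_of_le_pi (mul_nonneg (sub_nonneg.2 ht.2) h0.le) (by nlinarith [ht.1])
  have e1 := mul_le_mul_of_nonneg_right hx s1
  have e2 := mul_le_mul_of_nonneg_right hy s2
  have hsum : sin (t * dist x y) + sin ((1 - t) * dist x y) =
      2 * sin (dist x y / 2) * cos ((1 / 2 - t) * dist x y) := by
    rw [two_mul_sin_mul_cos]
    congr 2 <;> ring
  have hdouble : sin (dist x y) = 2 * sin (dist x y / 2) * cos (dist x y / 2) := by
    rw [← sin_two_mul]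
    congr 1
    ring
  rw [hdouble] at h
  have e3 : A * (2 * sin (dist x y / 2) * cos ((1 / 2 - t) * dist x y)) ≤
      cos (dist (convComb t x y) z) * (2 * sin (dist x y / 2) * cos (dist x y / 2)) := by
    rw [← hsum]
    linarith
  refine le_of_mul_le_mul_left ?_ hs
  linarith

theorem Quasinonexpansive.cos_dist_le {T : X → X} (hT : Quasinonexpansive T)
    (hd : ∀ v v' : X, dist v v' < π / 2) {p : X} (hp : T p = p) (x : X) :
    cos (dist x p) ≤ cos (dist (T x) p) :=
  cos_le_cos_of_nonneg_of_le_pi dist_nonneg (by linarith [hd x p, pi_pos]) (hT x p hp)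

theorem Quasinonexpansive.isClosed_fixedPoints {T : X → X} (hT : Quasinonexpansive T) :
    IsClosed (Function.fixedPoints T) := by
  refine isClosed_of_closure_subset fun p hp => ?_
  refine dist_le_zero.1 (le_of_forall_pos_le_add fun ε hε => ?_)
  obtain ⟨q, hq, hpq⟩ := Metric.mem_closure_iff.1 hp (ε / 2) (half_pos hε)
  linarith [dist_triangle_right (T p) p q, hT p q hq]

/-- The image Tm of the midpoint is within d(p,q)/2 of both p and q. The midpoint inequality with
third point Tm then yields cos d(m,Tm) ≥ 1. -/
theorem Quasinonexpansive.midpoint_mem_fixedPoints (hX : IsCAT1 X)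
    (hd : ∀ v v' : X, dist v v' < π / 2) {T : X → X} (hT : Quasinonexpansive T) {p q : X}
    (hp : p ∈ Function.fixedPoints T) (hq : q ∈ Function.fixedPoints T) :
    convComb (1 / 2) p q ∈ Function.fixedPoints T := by
  obtain ⟨h1, h2, -⟩ := hX.convComb_spec hd p q (t := 1 / 2) ⟨by norm_num, by norm_num⟩
  have h := hX.midpoint_spec hd p q (T (convComb (1 / 2) p q))
  set m := convComb (1 / 2) p q
  have hpT := hT.cos_dist_le hd hp m
  have hqT := hT.cos_dist_le hd hq m
  rw [dist_comm m p, dist_comm (T m) p, h1] at hpT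
  rw [h2, dist_comm (T m) q] at hqT
  have hc : 0 < cos (dist p q / 2) := cos_pos_of_mem_Ioo
    ⟨by linarith [pi_pos, dist_nonneg (x := p) (y := q)], by linarith [hd p q, pi_pos]⟩
  rw [show (1 - 1 / 2 : ℝ) * dist p q = dist p q / 2 by ring] at hpT
  rw [show (1 / 2 : ℝ) * dist p q = dist p q / 2 by ring] at hqT
  have h1' : 1 ≤ cos (dist m (T m)) := by
    refine le_of_mul_le_mul_right ?_ hc
    linarith
  have h0 : cos (dist m (T m)) = 1 := le_antisymm (cos_le_one _) h1'
  have hz := (cos_eq_one_iff_of_lt_of_lt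
    (by linarith [pi_pos, dist_nonneg (x := m) (y := T m)])
    (by linarith [hd m (T m), pi_pos])).1 h0
  exact (dist_eq_zero.1 hz).symm

theorem cos_dist_le_wMapping (hX : IsCAT1 X) (hd : ∀ v v' : X, dist v v' < π / 2) {p : X}
    (x : X) : ∀ (r : ℕ) (T : Fin r → X → X) (α : Fin r → ℝ),
      (∀ i, Quasinonexpansive (T i)) → (∀ i, T i p = p) → (∀ i, α i ∈ Set.Icc (0 : ℝ) 1) →
      cos (dist x p) ≤ cos (dist (wMapping r T α x) p)
  | 0, _, _, _, _, _ => le_rfl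
  | r + 1, T, α, hT, hp, hα => by
    have h := cos_dist_le_wMapping hX hd x r (fun i => T i.castSucc) (fun i => α i.castSucc)
      (fun i => hT _) (fun i => hp _) (fun i => hα _)
    have h1 := h.trans ((hT (Fin.last r)).cos_dist_le hd (hp _) _)
    have h2 := hX.concave_cos_dist hd
      (T (Fin.last r) (wMapping r (fun i => T i.castSucc) (fun i => α i.castSucc) x)) x p
      (hα (Fin.last r))
    have h3 := mul_le_mul_of_nonneg_left h1 (hα (Fin.last r)).1
    rw [wMapping]
    linarith

theorem mul_sq_le_cos_sub_cos {a D : ℝ} (ha0 : 0 ≤ a) (ha : a ≤ 1) (hD : 0 ≤ D)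
    (hDπ : D ≤ π / 2) :
    2 / π ^ 2 * (1 - a) * a * D ^ 2 ≤ cos ((1 / 2 - a) * D) - cos (D / 2) := by
  have h1 : 2 / π * ((1 - a) * D / 2) ≤ sin ((1 - a) * D / 2) :=
    mul_le_sin (by have := sub_nonneg.2 ha; positivity) (by nlinarith)
  have h2 : 2 / π * (a * D / 2) ≤ sin (a * D / 2) :=
    mul_le_sin (by positivity) (by nlinarith)
  have h3 : cos ((1 / 2 - a) * D) - cos (D / 2) =
      2 * (sin ((1 - a) * D / 2) * sin (a * D / 2)) := by
    rw [cos_sub_cos, show ((1 / 2 - a) * D + D / 2) / 2 = (1 - a) * D / 2 by ring,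
      show ((1 / 2 - a) * D - D / 2) / 2 = -(a * D / 2) by ring, sin_neg]
    ring
  have h0 : 0 ≤ 2 / π * (a * D / 2) := by positivity
  have h0' : 0 ≤ 2 / π * ((1 - a) * D / 2) := by
    have := sub_nonneg.2 ha
    positivity
  have h4 := mul_le_mul h1 h2 h0 (h0'.trans h1)
  rw [h3]
  calc 2 / π ^ 2 * (1 - a) * a * D ^ 2
      = 2 * (2 / π * ((1 - a) * D / 2) * (2 / π * (a * D / 2))) := by field_simp
    _ ≤ _ := by linarith

/-- If a W-mapping asymptotically does not decrease the distance to a common fixed point, then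
the generating maps have approximate fixed points near the sequence. -/
theorem wMapping_regular (hX : IsCAT1 X) (hd : ∀ v v' : X, dist v v' < π / 2) {p : X}
    {a c : ℝ} (ha0 : 0 < a) (ha : a < 1 / 2) (hc0 : 0 < c) {x : ℕ → X}
    (hc : ∀ n, c ≤ cos (dist (x n) p)) :
    ∀ (r : ℕ) (T : Fin r → X → X) (α : ℕ → Fin r → ℝ),
      (∀ i, Quasinonexpansive (T i)) → (∀ i, T i p = p) → (∀ n i, α n i ∈ Set.Icc a (1 - a)) →
      Tendsto (fun n => cos (dist (wMapping r T (α n) (x n)) p) - cos (dist (x n) p)) atTop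
        (𝓝 0) →
      Tendsto (fun n => dist (wMapping r T (α n) (x n)) (x n)) atTop (𝓝 0) ∧
        ∀ i, ∃ y : ℕ → X, Tendsto (fun n => dist (y n) (x n)) atTop (𝓝 0) ∧
          Tendsto (fun n => dist (T i (y n)) (y n)) atTop (𝓝 0)
  | 0, _, _, _, _, _, _ => ⟨by simp [wMapping], fun i => i.elim0⟩
  | r + 1, T, α, hT, hp, hα, h => by
    have hα' : ∀ n i, α n i ∈ Set.Icc (0 : ℝ) 1 := fun n i =>
      ⟨ha0.le.trans (hα n i).1, by linarith [(hα n i).2]⟩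
    set V : ℕ → X := fun n =>
      wMapping r (fun i => T i.castSucc) (fun i => α n i.castSucc) (x n) with hV
    set e : ℕ → ℝ := fun n =>
      cos (dist (wMapping (r + 1) T (α n) (x n)) p) - cos (dist (x n) p) with he
    have hW : ∀ n, wMapping (r + 1) T (α n) (x n) =
        convComb (α n (Fin.last r)) (T (Fin.last r) (V n)) (x n) := fun n => rfl
    have hVx : ∀ n, cos (dist (x n) p) ≤ cos (dist (V n) p) := fun n =>
      cos_dist_le_wMapping hX hd _ _ _ _ (fun i => hT _) (fun i => hp _) (fun i => hα' n _)
    have hTV : ∀ n, cos (dist (V n) p) ≤ cos (dist (T (Fin.last r) (V n)) p) := fun n =>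
      (hT _).cos_dist_le hd (hp _) _
    -- Concavity with weight at least a on T V shows that the gain of the inner W-mapping is at most
    -- 1/a times the total gain, so the induction hypothesis applies.
    have hVe : Tendsto (fun n => cos (dist (V n) p) - cos (dist (x n) p)) atTop (𝓝 0) := by
      refine squeeze_zero (fun n => sub_nonneg.2 (hVx n)) (fun n => ?_)
        (g := fun n => e n / a) (by simpa using h.div_const a)
      rw [le_div_iff₀ ha0]
      have h1 := hX.concave_cos_dist hd (T (Fin.last r) (V n)) (x n) p (hα' n (Fin.last r))
      have h2 : α n (Fin.last r) * (cos (dist (T (Fin.last r) (V n)) p) - cos (dist (x n) p)) ≤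
          e n := by
        simp only [he, hW]
        linarith
      have h3 := mul_le_mul (hα n (Fin.last r)).1
        (sub_le_sub_right (hTV n) (cos (dist (x n) p))) (sub_nonneg.2 (hVx n))
        (hα' n (Fin.last r)).1
      linarith
    obtain ⟨ih1, ih2⟩ := wMapping_regular hX hd ha0 ha hc0 hc r (fun i => T i.castSucc)
      (fun n i => α n i.castSucc) (fun i => hT _) (fun i => hp _) (fun n i => hα _ _) hVe
    -- The gain of the last averaging step is at least a multiple of d(TV,x)²; the multiple is
    -- positive because cos d(xₙ,p) ≥ c > 0 and the weights stay away from 0 and 1.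
    have hD : Tendsto (fun n => dist (T (Fin.last r) (V n)) (x n)) atTop (𝓝 0) := by
      have hK : 0 < c * (2 / π ^ 2 * (1 - a) * a) := by
        have : 0 < 1 - a := by linarith
        positivity
      have hsq : Tendsto (fun n => sqrt (e n / (c * (2 / π ^ 2 * (1 - a) * a)))) atTop
          (𝓝 0) := by
        simpa using (h.div_const (c * (2 / π ^ 2 * (1 - a) * a))).sqrt
      refine squeeze_zero (fun n => dist_nonneg) (fun n => le_sqrt_of_sq_le ?_) hsq
      rw [le_div_iff₀ hK]
      have h1 := hX.mul_cos_le_convComb hd (hα' n (Fin.last r)) ((hVx n).trans (hTV n)) le_rfl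
      rw [← hW] at h1
      set D := dist (T (Fin.last r) (V n)) (x n)
      have hD0 : 0 ≤ D := dist_nonneg
      have hDπ : D ≤ π / 2 := (hd _ _).le
      have h2 := mul_sq_le_cos_sub_cos ha0.le (by linarith) hD0 hDπ
      have h3 : cos ((1 / 2 - a) * D) ≤ cos ((1 / 2 - α n (Fin.last r)) * D) := by
        rw [← cos_abs ((1 / 2 - α n (Fin.last r)) * D), abs_mul, abs_of_nonneg hD0]
        have habs : |1 / 2 - α n (Fin.last r)| ≤ 1 / 2 - a :=
          abs_le.2 ⟨by linarith [(hα n (Fin.last r)).2], by linarith [(hα n (Fin.last r)).1]⟩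
        exact cos_le_cos_of_nonneg_of_le_pi (by positivity)
          (by nlinarith [pi_pos]) (mul_le_mul_of_nonneg_right habs hD0)
      have hcD : 0 ≤ cos (D / 2) := cos_nonneg_of_neg_pi_div_two_le_of_le
        (by linarith [pi_pos]) (by linarith [pi_pos])
      have he0 : 0 ≤ e n := sub_nonneg.2
        (cos_dist_le_wMapping hX hd _ _ _ _ hT hp (fun i => hα' n i))
      have hxn := hc0.le.trans (hc n)
      have h4 : cos (dist (x n) p) * (cos ((1 / 2 - a) * D) - cos (D / 2)) ≤
          e n * cos (D / 2) := by
        have := mul_le_mul_of_nonneg_left h3 hxn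
        simp only [he]
        linarith
      have h5 : e n * cos (D / 2) ≤ e n := mul_le_of_le_one_right he0 (cos_le_one _)
      have h6 : 0 ≤ 2 / π ^ 2 * (1 - a) * a * D ^ 2 := by
        have : 0 < 1 - a := by linarith
        positivity
      have h7 := mul_le_mul (hc n) h2 h6 hxn
      linarith
    refine ⟨squeeze_zero (fun n => dist_nonneg) (fun n => ?_) hD, fun i => ?_⟩
    · rw [hW, (hX.convComb_spec hd _ _ (hα' n (Fin.last r))).2.1]
      exact mul_le_of_le_one_left dist_nonneg (hα' n _).2
    · refine Fin.lastCases ⟨V, ih1, ?_⟩ (fun i => ih2 i) i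
      refine squeeze_zero (fun n => dist_nonneg) (fun n => dist_triangle_right _ _ (x n)) ?_
      simpa using hD.add ih1

end

/-! ### The Halpern iteration -/

/-- Dividing the cosine inequality by sin D leaves sin((1-β)D)/sin D as the weight of B; calling it
1-γ, the weight sin(βD)/sin D of A is γ times the stated quotient of cosines. The two lower bounds
on γ correspond to D bounded away from π/2 and to arbitrary D < π/2. -/
theorem exists_halpern_rate {D β : ℝ} (hD : 0 ≤ D) (hDπ : D < π / 2) (hβ0 : 0 < β)
    (hβ1 : β < 1) :
    ∃ γ, 2 / π * (β * cos D) ≤ γ ∧ β ^ 2 / π ≤ γ ∧ γ ≤ β * (π / 2) ∧ γ ≤ 1 ∧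
      ∀ A B C : ℝ, A * sin (β * D) + B * sin ((1 - β) * D) ≤ C * sin D →
        (D = 0 → A = B ∧ B ≤ C) →
        1 - C ≤ (1 - γ) * (1 - B) + γ * (1 - A * (cos (β * D / 2) / cos (D - β * D / 2))) := by
  have hπ := pi_gt_three
  rcases hD.eq_or_lt with rfl | hD
  · refine ⟨β, ?_, ?_, by nlinarith, hβ1.le, fun A B C _ h => ?_⟩
    · rw [cos_zero, div_mul_eq_mul_div, div_le_iff₀ pi_pos]
      nlinarith
    · rw [div_le_iff₀ pi_pos]
      nlinarith
    · obtain ⟨rfl, h⟩ := h rfl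
      simp only [mul_zero, zero_div, sub_zero, cos_zero, div_one, mul_one]
      linarith
  have hs : 0 < sin D := sin_pos_of_pos_of_lt_pi hD (by linarith)
  have hβD : 0 < β * D := mul_pos hβ0 hD
  have hβD' : β * D < D := by nlinarith
  have hdiff : sin D - sin ((1 - β) * D) = 2 * sin (β * D / 2) * cos (D - β * D / 2) := by
    rw [sin_sub_sin]
    congr 2
    · congr 1; ring
    · ring
  have hcos : 0 < cos (D - β * D / 2) := cos_pos_of_mem_Ioo ⟨by linarith, by linarith⟩
  have hh0 : 0 ≤ sin (β * D / 2) := sin_nonneg_of_nonneg_of_le_pi (by linarith) (by linarith)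
  have hhle : sin (β * D / 2) ≤ β * D / 2 := sin_le (by linarith)
  have hhge : 2 / π * (β * D / 2) ≤ sin (β * D / 2) := mul_le_sin (by linarith) (by linarith)
  have hsD : sin D ≤ D := sin_le hD.le
  have hDs : 2 / π * D ≤ sin D := mul_le_sin hD.le hDπ.le
  have hlow : 2 / π * (β * sin D) ≤ 2 * sin (β * D / 2) := by
    have h1 : 2 / π * (β * sin D) ≤ 2 / π * (β * D) := by gcongr
    linarith
  have hgam : (sin D - sin ((1 - β) * D)) / sin D = 1 - sin ((1 - β) * D) / sin D := by
    rw [sub_div, div_self hs.ne']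
  refine ⟨(sin D - sin ((1 - β) * D)) / sin D, ?_, ?_, ?_, ?_, fun A B C h _ => ?_⟩
  · rw [le_div_iff₀ hs, hdiff]
    have h1 : cos D ≤ cos (D - β * D / 2) :=
      cos_le_cos_of_nonneg_of_le_pi (by linarith) (by linarith) (by linarith)
    have h2 := mul_le_mul hlow h1 (cos_nonneg_of_neg_pi_div_two_le_of_le (by linarith) hDπ.le)
      (by positivity)
    linarith
  · rw [le_div_iff₀ hs, hdiff]
    -- Even as D approaches π/2, the angle D - βD/2 stays at least βπ/4 below π/2, and Jordan's
    -- inequality applies to the complement.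
    have h1 : β / 2 ≤ cos (D - β * D / 2) := by
      have h0 : β * π / 4 ≤ π / 2 - (D - β * D / 2) := by nlinarith
      rw [← sin_pi_div_two_sub]
      have := mul_le_sin (x := π / 2 - (D - β * D / 2)) (by nlinarith) (by linarith)
      have h2 : 2 / π * (β * π / 4) ≤ 2 / π * (π / 2 - (D - β * D / 2)) := by gcongr
      have h3 : 2 / π * (β * π / 4) = β / 2 := by field_simp; ring
      linarith
    have h2 := mul_le_mul hlow h1 (by linarith) (by positivity)
    have h3 : β ^ 2 / π * sin D = 2 / π * (β * sin D) * (β / 2) := by field_simp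
    linarith
  · rw [div_le_iff₀ hs, hdiff]
    have h1 : 2 * sin (β * D / 2) * cos (D - β * D / 2) ≤ 2 * sin (β * D / 2) :=
      mul_le_of_le_one_right (by linarith) (cos_le_one _)
    have h2 : D ≤ π / 2 * sin D := by
      have := mul_le_mul_of_nonneg_left hDs (by positivity : 0 ≤ π / 2)
      rwa [← mul_assoc, show π / 2 * (2 / π) = 1 by field_simp, one_mul] at this
    nlinarith
  · rw [div_le_one hs]
    have : 0 ≤ sin ((1 - β) * D) :=
      sin_nonneg_of_nonneg_of_le_pi (by nlinarith) (by nlinarith)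
    linarith
  · have hA : (sin D - sin ((1 - β) * D)) / sin D * (cos (β * D / 2) / cos (D - β * D / 2)) =
        sin (β * D) / sin D := by
      rw [hdiff, show sin (β * D) = 2 * sin (β * D / 2) * cos (β * D / 2) by
        rw [← sin_two_mul]; congr 1; ring]
      generalize cos (D - β * D / 2) = q at hcos
      field_simp
    have hC : A * (sin (β * D) / sin D) + B * (sin ((1 - β) * D) / sin D) ≤ C := by
      rw [← mul_div_assoc, ← mul_div_assoc, ← add_div, div_le_iff₀ hs]
      exact h
    rw [← hA] at hC
    have hB : sin ((1 - β) * D) / sin D = 1 - (sin D - sin ((1 - β) * D)) / sin D := by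
      rw [hgam]; ring
    rw [hB] at hC
    linarith

/-- A sequence contracted towards `(-∞, ε]` at rates with divergent sum. -/
theorem eventually_le_of_contracting {s γ : ℕ → ℝ} {ε : ℝ} (hε : 0 < ε) (hγ1 : ∀ n, γ n ≤ 1)
    (hγ : Tendsto (fun N => ∑ n ∈ Finset.range N, γ n) atTop atTop)
    (hs : ∀ n, s n ≤ 1) (h : ∀ᶠ n in atTop, s (n + 1) ≤ (1 - γ n) * s n + γ n * ε) :
    ∀ᶠ n in atTop, s n < 2 * ε := by
  obtain ⟨N, hN⟩ := eventually_atTop.1 h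
  have hind : ∀ n ≥ N, s n - ε ≤
      exp (∑ i ∈ Finset.range N, γ i - ∑ i ∈ Finset.range n, γ i) := by
    intro n hn
    induction n, hn using Nat.le_induction with
    | base => rw [sub_self, exp_zero]; linarith [hs N]
    | succ n hn ih =>
      have h1 : 1 - γ n ≤ exp (-γ n) := by linarith [add_one_le_exp (-γ n)]
      have h2 := mul_le_mul_of_nonneg_left ih (sub_nonneg.2 (hγ1 n))
      have h3 := mul_le_mul_of_nonneg_right h1
        (exp_pos (∑ i ∈ Finset.range N, γ i - ∑ i ∈ Finset.range n, γ i)).le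
      rw [Finset.sum_range_succ, show ∑ i ∈ Finset.range N, γ i -
        (∑ i ∈ Finset.range n, γ i + γ n) = -γ n +
          (∑ i ∈ Finset.range N, γ i - ∑ i ∈ Finset.range n, γ i) by ring, exp_add]
      linarith [hN n hn]
  have hlim : Tendsto (fun n => exp (∑ i ∈ Finset.range N, γ i - ∑ i ∈ Finset.range n, γ i))
      atTop (𝓝 0) :=
    tendsto_exp_atBot.comp (tendsto_atBot_add_const_left _ _ (tendsto_neg_atTop_atBot.comp hγ))
  filter_upwards [hlim.eventually (gt_mem_nhds hε), eventually_ge_atTop N] with n h1 h2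
  linarith [hind n h2]

section

variable {X : Type*} [MetricSpace X]

/-- Along steps at which the W-mapping hardly improves the distance to the nearest common fixed
point `p`, the anchor `u` is asymptotically not closer to the iterates than to `p`. -/
theorem eventually_anchor_le [CompleteSpace X] (hX : IsCAT1 X)
    (hd : ∀ v v' : X, dist v v' < π / 2) {r : ℕ} {T : Fin r → X → X}
    (hTq : ∀ i, Quasinonexpansive (T i)) (hTd : ∀ i, DeltaDemiclosed (T i)) {u p : X}
    (hp : IsNearestPoint (⋂ i, Function.fixedPoints (T i)) u p) {a M : ℝ} (ha0 : 0 < a)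
    (ha : a < 1 / 2) {α : ℕ → Fin r → ℝ} (hα : ∀ n i, α n i ∈ Set.Icc a (1 - a)) {β : ℕ → ℝ}
    (hβ : ∀ n, 0 < β n ∧ β n < 1) (hβ0 : Tendsto β atTop (𝓝 0)) {x : ℕ → X} (hM : M < π / 2) (hxM : ∀ n, dist (x n) p ≤ M)
    {ε : ℝ} (hε : 0 < ε) :
    ∃ δ > 0, ∀ᶠ n in atTop,
      cos (dist (wMapping r T (α n) (x n)) p) - cos (dist (x n) p) ≤ δ →
      1 - cos (dist u p) * (cos (β n * dist u (wMapping r T (α n) (x n)) / 2) /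
        cos (dist u (wMapping r T (α n) (x n)) -
          β n * dist u (wMapping r T (α n) (x n)) / 2)) ≤ ε := by
  have hpT : ∀ i, T i p = p := fun i => Set.mem_iInter.1 hp.1 i
  have hα' : ∀ n i, α n i ∈ Set.Icc (0 : ℝ) 1 := fun n i =>
    ⟨ha0.le.trans (hα n i).1, by linarith [(hα n i).2]⟩
  -- Failure for every δ = 1/(k+1) produces a subsequence whose W-gains tend to 0 while the
  -- conclusion fails throughout.
  by_contra! hcon
  obtain ⟨φ, hφ, hφ'⟩ := extraction_forall_of_frequently
    (fun k : ℕ => hcon (1 / ((k : ℝ) + 1)) (by positivity))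
  have hM0 : 0 ≤ M := dist_nonneg.trans (hxM 0)
  have hreg := wMapping_regular hX hd ha0 ha (x := x ∘ φ)
    (cos_pos_of_mem_Ioo ⟨by linarith [pi_pos], hM⟩ : 0 < cos M)
    (fun n => cos_le_cos_of_nonneg_of_le_pi dist_nonneg (by linarith [pi_pos]) (hxM (φ n)))
    r T (fun n => α (φ n)) hTq hpT (fun n => hα _)
    (squeeze_zero (fun n => sub_nonneg.2 (cos_dist_le_wMapping hX hd _ r T _ hTq hpT (hα' _)))
      (fun n => (hφ' n).1) tendsto_one_div_add_atTop_nhds_zero_nat)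
  obtain ⟨hWx, hy⟩ := hreg
  obtain ⟨θ, hθ, z, hz⟩ := hX.exists_deltaTendsto_subseq hd (x := x ∘ φ) (p := p) hM
    (fun n => by rw [dist_comm]; exact hxM _)
  have hzF : ∀ i, T i z = z := fun i => by
    obtain ⟨y, hy1, hy2⟩ := hy i
    exact hTd i (y ∘ θ) z (hz.congr_dist hd (hy1.comp hθ.tendsto_atTop))
      (hy2.comp hθ.tendsto_atTop)
  obtain ⟨L, hL, η, hη, hLη⟩ := tendsto_subseq_of_bounded
    (Metric.isBounded_Icc (0 : ℝ) (π / 2))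
    (fun n => (⟨dist_nonneg, (hd _ _).le⟩ : dist u (x (φ (θ n))) ∈ Set.Icc 0 (π / 2)))
  rw [isClosed_Icc.closure_eq] at hL
  have huL : dist u p ≤ L := by
    have h1 := hX.dist_le_limsup hd (hz.comp hη).mem_asymptoticCenter u
    have h2 : limsup (fun n => dist u ((((x ∘ φ) ∘ θ) ∘ η) n)) atTop = L := hLη.limsup_eq
    exact ((hp.2 z (Set.mem_iInter.2 hzF)).trans h1).trans h2.le
  have hsub : Tendsto (θ ∘ η) atTop atTop := hθ.tendsto_atTop.comp hη.tendsto_atTop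
  set D : ℕ → ℝ := fun n =>
    dist u (wMapping r T (α (φ (θ (η n)))) (x (φ (θ (η n))))) with hDdef
  have hDL : Tendsto D atTop (𝓝 L) := by
    have h1 : Tendsto (fun n => D n - dist u (x (φ (θ (η n))))) atTop (𝓝 0) := by
      refine squeeze_zero_norm (fun n => ?_) (hWx.comp hsub)
      rw [Real.norm_eq_abs]
      simp only [hDdef]
      rw [dist_comm u, dist_comm u]
      exact abs_dist_sub_le _ _ _
    simpa using h1.add hLη
  have hβ' : Tendsto (fun n => β (φ (θ (η n)))) atTop (𝓝 0) :=
    hβ0.comp (hφ.tendsto_atTop.comp hsub)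
  have hβD : Tendsto (fun n => β (φ (θ (η n))) * D n / 2) atTop (𝓝 0) := by
    simpa using (hβ'.mul hDL).div_const 2
  have hl1 : Tendsto (fun n => cos (dist u p) * cos (β (φ (θ (η n))) * D n / 2)) atTop
      (𝓝 (cos (dist u p))) := by
    simpa using ((continuous_cos.tendsto 0).comp hβD).const_mul (cos (dist u p))
  have hl2 : Tendsto (fun n => (1 - ε) * cos (D n - β (φ (θ (η n))) * D n / 2)) atTop
      (𝓝 ((1 - ε) * cos L)) := by
    have := hDL.sub hβD
    rw [sub_zero] at this
    exact ((continuous_cos.tendsto L).comp this).const_mul (1 - ε)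
  -- The denominator is cleared before the limit, since L = π/2 is possible and cos L may vanish.
  have hle : cos (dist u p) ≤ (1 - ε) * cos L := by
    refine le_of_tendsto_of_tendsto' hl1 hl2 fun n => ?_
    have h := (hφ' (θ (η n))).2
    obtain ⟨hb0, hb1⟩ := hβ (φ (θ (η n)))
    have hD0 : 0 ≤ D n := dist_nonneg
    have hDπ : D n < π / 2 := hd _ _
    have hpos : 0 < cos (D n - β (φ (θ (η n))) * D n / 2) := by
      refine cos_pos_of_mem_Ioo ⟨by nlinarith [pi_pos], ?_⟩
      linarith [mul_nonneg hb0.le hD0]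
    have h' : ε < 1 - cos (dist u p) * (cos (β (φ (θ (η n))) * D n / 2) /
        cos (D n - β (φ (θ (η n))) * D n / 2)) := h
    rw [← mul_div_assoc, lt_sub_comm, div_lt_iff₀ hpos] at h'
    exact h'.le
  have hLcos : cos L ≤ cos (dist u p) :=
    cos_le_cos_of_nonneg_of_le_pi dist_nonneg (by linarith [hL.2, pi_pos]) huL
  have hLpos : 0 ≤ cos L :=
    cos_nonneg_of_neg_pi_div_two_le_of_le (by linarith [hL.1, pi_pos]) hL.2
  have hup : 0 < cos (dist u p) := cos_pos_of_mem_Ioo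
    ⟨by linarith [pi_pos, dist_nonneg (x := u) (y := p)], hd _ _⟩
  rcases hLpos.eq_or_lt with h | h
  · rw [← h, mul_zero] at hle
    linarith
  · linarith [mul_pos hε h]

/-- Convergence of the Halpern iteration for W-mappings when the rates have divergent sum. -/
theorem halpern_tendsto [CompleteSpace X] (hX : IsCAT1 X)
    (hd : ∀ v v' : X, dist v v' < π / 2) {r : ℕ} {T : Fin r → X → X}
    (hTq : ∀ i, Quasinonexpansive (T i)) (hTd : ∀ i, DeltaDemiclosed (T i)) {u p : X}
    (hp : IsNearestPoint (⋂ i, Function.fixedPoints (T i)) u p) {a M : ℝ} (ha0 : 0 < a)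
    (ha : a < 1 / 2) {α : ℕ → Fin r → ℝ} (hα : ∀ n i, α n i ∈ Set.Icc a (1 - a)) {β : ℕ → ℝ}
    (hβ : ∀ n, 0 < β n ∧ β n < 1) (hβ0 : Tendsto β atTop (𝓝 0)) {x : ℕ → X}
    (hx : ∀ n, x (n + 1) = convComb (β n) u (wMapping r T (α n) (x n)))
    (hM : M < π / 2) (hxM : ∀ n, dist (x n) p ≤ M)
    (hsum : ∀ γ : ℕ → ℝ,
      (∀ n, 2 / π * (β n * cos (dist u (wMapping r T (α n) (x n)))) ≤ γ n) →
      (∀ n, β n ^ 2 / π ≤ γ n) →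
      Tendsto (fun N => ∑ n ∈ Finset.range N, γ n) atTop atTop) :
    Tendsto x atTop (𝓝 p) := by
  have hpT : ∀ i, T i p = p := fun i => Set.mem_iInter.1 hp.1 i
  have hα' : ∀ n i, α n i ∈ Set.Icc (0 : ℝ) 1 := fun n i =>
    ⟨ha0.le.trans (hα n i).1, by linarith [(hα n i).2]⟩
  have hWp : ∀ n, cos (dist (x n) p) ≤ cos (dist (wMapping r T (α n) (x n)) p) := fun n =>
    cos_dist_le_wMapping hX hd _ r T _ hTq hpT (hα' n)
  choose γ hγ1 hγ2 hγ3 hγ4 hγ5 using fun n =>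
    exists_halpern_rate (dist_nonneg (x := u) (y := wMapping r T (α n) (x n))) (hd _ _)
      (hβ n).1 (hβ n).2
  have hγ0 : ∀ n, 0 ≤ γ n := fun n => le_trans (by positivity) (hγ2 n)
  have hγlim : Tendsto γ atTop (𝓝 0) :=
    squeeze_zero hγ0 hγ3 (by simpa using hβ0.mul_const (π / 2))
  have hstep := fun n => hγ5 n (cos (dist u p)) (cos (dist (wMapping r T (α n) (x n)) p))
    (cos (dist (x (n + 1)) p))
    (by rw [hx n]; exact (hX.convComb_spec hd _ _ ⟨(hβ n).1.le, (hβ n).2.le⟩).2.2 p)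
    (fun h => by
      rw [hx n, hX.eq_left_of_dist_eq_zero hd ⟨(hβ n).1.le, (hβ n).2.le⟩ h, dist_eq_zero.1 h]
      exact ⟨rfl, le_rfl⟩)
  set s : ℕ → ℝ := fun n => 1 - cos (dist (x n) p) with hs
  have hs1 : ∀ n, s n ≤ 1 := fun n => by linarith [cos_dist_nonneg hd (x n) p]
  have hs0 : ∀ n, 0 ≤ s n := fun n => sub_nonneg.2 (cos_le_one _)
  have hcontr : ∀ ε > 0, ∀ᶠ n in atTop, s (n + 1) ≤ (1 - γ n) * s n + γ n * ε := by
    intro ε hε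
    obtain ⟨δ, hδ, hev⟩ := eventually_anchor_le hX hd hTq hTd hp ha0 ha hα hβ hβ0 hM hxM hε
    filter_upwards [hev, hγlim.eventually (gt_mem_nhds (by positivity : 0 < δ / 2)),
      hγlim.eventually (gt_mem_nhds (by positivity : (0 : ℝ) < 1 / 2))] with n h1 h2 h3
    have hn := hstep n
    have hw := hWp n
    -- A gain above δ lowers the main term by at least (1-γ)δ ≥ δ/2 ≥ γ, which pays for the whole
    -- anchor term; a gain of at most δ makes that term at most γε.
    rcases le_or_gt (cos (dist (wMapping r T (α n) (x n)) p) - cos (dist (x n) p)) δ with hc | hc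
    · have e1 := mul_le_mul_of_nonneg_left (h1 hc) (hγ0 n)
      have e2 := mul_le_mul_of_nonneg_left hw (sub_nonneg.2 (hγ4 n))
      simp only [hs]
      linarith
    · have hratio : 0 ≤ cos (dist u p) *
          (cos (β n * dist u (wMapping r T (α n) (x n)) / 2) /
            cos (dist u (wMapping r T (α n) (x n)) -
              β n * dist u (wMapping r T (α n) (x n)) / 2)) := by
        have hD0 := dist_nonneg (x := u) (y := wMapping r T (α n) (x n))
        have hDπ := hd u (wMapping r T (α n) (x n))
        obtain ⟨hb0, hb1⟩ := hβ n
        refine mul_nonneg (cos_dist_nonneg hd u p) (div_nonneg ?_ ?_) <;>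
          exact cos_nonneg_of_neg_pi_div_two_le_of_le (by nlinarith [pi_pos]) (by nlinarith)
      have e1 := mul_nonneg (hγ0 n) hratio
      have e2 := mul_le_mul_of_nonneg_left hc.le (sub_nonneg.2 (hγ4 n))
      have e3 := mul_nonneg (hγ0 n) hε.le
      have e4 := mul_le_mul_of_nonneg_left (sub_le_sub_right h3.le (1 / 2)) hδ.le
      simp only [hs]
      linarith
  have hslim : Tendsto s atTop (𝓝 0) := by
    refine tendsto_order.2 ⟨fun b hb => Eventually.of_forall fun n => hb.trans_le (hs0 n),
      fun b hb => ?_⟩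
    have := eventually_le_of_contracting (half_pos hb) hγ4 (hsum γ hγ1 hγ2) hs1
      (hcontr _ (half_pos hb))
    simpa [mul_div_cancel₀] using this
  rw [tendsto_iff_dist_tendsto_zero]
  have hsq : Tendsto (fun n => sqrt (π ^ 2 / 2 * s n)) atTop (𝓝 0) := by
    simpa using (hslim.const_mul (π ^ 2 / 2)).sqrt
  refine squeeze_zero (fun n => dist_nonneg) (fun n => le_sqrt_of_sq_le ?_) hsq
  have hc := cos_le_one_sub_mul_cos_sq (x := dist (x n) p)
    (by rw [abs_of_nonneg dist_nonneg]; linarith [hd (x n) p, pi_pos])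
  have hc' : 2 / π ^ 2 * dist (x n) p ^ 2 ≤ s n := by simp only [hs]; linarith
  calc dist (x n) p ^ 2 = π ^ 2 / 2 * (2 / π ^ 2 * dist (x n) p ^ 2) := by field_simp
    _ ≤ _ := by gcongr

theorem halpern_bounded (hX : IsCAT1 X) (hd : ∀ v v' : X, dist v v' < π / 2) {r : ℕ}
    {T : Fin r → X → X} (hTq : ∀ i, Quasinonexpansive (T i)) {u p : X} (hpT : ∀ i, T i p = p)
    {α : ℕ → Fin r → ℝ} (hα : ∀ n i, α n i ∈ Set.Icc (0 : ℝ) 1) {β : ℕ → ℝ}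
    (hβ : ∀ n, 0 < β n ∧ β n < 1) {x : ℕ → X}
    (hx : ∀ n, x (n + 1) = convComb (β n) u (wMapping r T (α n) (x n))) (n : ℕ) :
    dist (x n) p ≤ max (dist u p) (dist (x 0) p) := by
  have hmax : max (dist u p) (dist (x 0) p) ∈ Set.Icc 0 π :=
    ⟨dist_nonneg.trans (le_max_left _ _), max_le (by linarith [hd u p, pi_pos])
      (by linarith [hd (x 0) p, pi_pos])⟩
  have hmem : ∀ y, dist y p ∈ Set.Icc 0 π := fun y =>
    ⟨dist_nonneg, by linarith [hd y p, pi_pos]⟩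
  induction n with
  | zero => exact le_max_right _ _
  | succ n ih =>
    refine (strictAntiOn_cos.le_iff_ge hmax (hmem _)).1 ?_
    have h1 := (strictAntiOn_cos.le_iff_ge hmax (hmem _)).2 ih
    have h2 := (strictAntiOn_cos.le_iff_ge hmax (hmem u)).2 (le_max_left _ _)
    have h3 := h1.trans (cos_dist_le_wMapping hX hd _ r T _ hTq hpT (hα n))
    have h4 := hX.concave_cos_dist hd u (wMapping r T (α n) (x n)) p (t := β n)
      ⟨(hβ n).1.le, (hβ n).2.le⟩
    rw [← hx n] at h4
    have e1 := mul_le_mul_of_nonneg_left h2 (hβ n).1.le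
    have e2 := mul_le_mul_of_nonneg_left h3 (sub_nonneg.2 (hβ n).2.le)
    linarith

end

end CAT1

/-! ### The nearest common fixed point and the three sufficient conditions -/

theorem theorem3p4 {X : Type*} [MetricSpace X] [CompleteSpace X]
    (hX : CAT1.IsCAT1 X) (hdist : ∀ v v' : X, dist v v' < Real.pi / 2)
    (r : ℕ) (T : Fin r → X → X)
    (hTq : ∀ i, CAT1.Quasinonexpansive (T i)) (hTd : ∀ i, CAT1.DeltaDemiclosed (T i))
    (F : Set X) (hF : F = ⋂ i, Function.fixedPoints (T i)) (hFne : F.Nonempty)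
    (a : ℝ) (ha0 : 0 < a) (ha : a < 1 / 2)
    (α : ℕ → Fin r → ℝ) (hα : ∀ n i, α n i ∈ Set.Icc a (1 - a))
    (W : ℕ → X → X) (hW : ∀ n, W n = CAT1.wMapping r T (α n))
    (β : ℕ → ℝ) (hβ : ∀ n, 0 < β n ∧ β n < 1) (hβ0 : Tendsto β atTop (𝓝 0))
    (hβsum : Tendsto (fun N => ∑ n ∈ Finset.range N, β n) atTop atTop)
    (u : X) (x : ℕ → X) (hx : ∀ n, x (n + 1) = CAT1.convComb (β n) u (W n (x n))) :
    ∃ p : X, CAT1.IsNearestPoint F u p ∧ (∀ q : X, CAT1.IsNearestPoint F u q → q = p) ∧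
      ((Metric.diam (Set.univ : Set X) < Real.pi / 2 ∨
        (dist u p < Real.pi / 4 ∧ dist u p + dist (x 0) p < Real.pi / 2) ∨
        Tendsto (fun N => ∑ n ∈ Finset.range N, β n ^ 2) atTop atTop) →
      Tendsto x atTop (𝓝 p)) := by
  obtain rfl : W = fun n => CAT1.wMapping r T (α n) := funext hW
  subst hF
  obtain ⟨p, hp, huniq⟩ := hX.existsUnique_isNearestPoint hdist
    (isClosed_iInter fun i => (hTq i).isClosed_fixedPoints) hFne
    (fun v hv w hw => Set.mem_iInter.2 fun i => (hTq i).midpoint_mem_fixedPoints hX hdist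
      (Set.mem_iInter.1 hv i) (Set.mem_iInter.1 hw i)) u
  refine ⟨p, hp, huniq, fun hcases => ?_⟩
  have hpT : ∀ i, T i p = p := fun i => Set.mem_iInter.1 hp.1 i
  have hα' : ∀ n i, α n i ∈ Set.Icc (0 : ℝ) 1 := fun n i =>
    ⟨ha0.le.trans (hα n i).1, by linarith [(hα n i).2]⟩
  have hxM := CAT1.halpern_bounded hX hdist hTq hpT hα' hβ hx
  refine CAT1.halpern_tendsto hX hdist hTq hTd hp ha0 ha hα hβ hβ0 hx
    (max_lt (hdist u p) (hdist (x 0) p)) hxM fun γ hγ1 hγ2 => ?_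
  have hbound : ∀ K < Real.pi / 2, (∀ n, dist u (CAT1.wMapping r T (α n) (x n)) ≤ K) →
      Tendsto (fun N => ∑ n ∈ Finset.range N, γ n) atTop atTop := by
    intro K hK hDK
    have hK0 : 0 ≤ K := dist_nonneg.trans (hDK 0)
    have hcK : 0 < Real.cos K := Real.cos_pos_of_mem_Ioo ⟨by linarith [Real.pi_pos], hK⟩
    refine tendsto_atTop_mono (fun N => ?_)
      (hβsum.const_mul_atTop (by positivity : 0 < 2 / Real.pi * Real.cos K))
    rw [Finset.mul_sum]
    refine Finset.sum_le_sum fun n _ => le_trans ?_ (hγ1 n)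
    have h1 := Real.cos_le_cos_of_nonneg_of_le_pi dist_nonneg (by linarith [Real.pi_pos]) (hDK n)
    have h2 := mul_le_mul_of_nonneg_left h1
      (by have := (hβ n).1; positivity : 0 ≤ 2 / Real.pi * β n)
    linarith
  rcases hcases with hdiam | ⟨hu, hux⟩ | hsq
  -- Boundedness of X is needed because `Metric.diam` is 0 on unbounded sets.
  · exact hbound _ hdiam fun n => Metric.dist_le_diam_of_mem
      (CAT1.isBounded_of_dist_lt hdist _) (Set.mem_univ _) (Set.mem_univ _)
  -- The triangle inequality through p gives this K; it is below π/2 since 2d(u,p) < π/2 and d(u,p)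
  -- + d(x₀,p) < π/2, where `x 0` is the initial point.
  · refine hbound (dist u p + max (dist u p) (dist (x 0) p)) ?_ fun n => ?_
    · rw [← max_add_add_left]
      exact max_lt (by linarith) hux
    · have h1 := CAT1.cos_dist_le_wMapping hX hdist (x n) r T (α n) hTq hpT (hα' n)
      have hmem : ∀ y, dist y p ∈ Set.Icc 0 Real.pi := fun y =>
        ⟨dist_nonneg, by linarith [hdist y p, Real.pi_pos]⟩
      have h2 := (Real.strictAntiOn_cos.le_iff_ge (hmem _) (hmem _)).1 h1
      linarith [dist_triangle_right u (CAT1.wMapping r T (α n) (x n)) p, hxM n]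
  · refine tendsto_atTop_mono (fun N => ?_) (hsq.atTop_div_const Real.pi_pos)
    rw [Finset.sum_div]
    exact Finset.sum_le_sum fun n _ => hγ2 n
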